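/- Let $\mathfrak g$ be a finite-dimensional simple Lie algebra over $\mathbb C$ with a $\mathbb Z_n$-grading $\mathfrak g=\bigoplus_{j\in\mathbb Z_n}\mathfrak g_j$ ($n\ge 1$, $[\mathfrak g_i,\mathfrak g_j]\subseteq\mathfrak g_{i+j}$), and put $\mathfrak g_+=\bigoplus_{j\ne 0}\mathfrak g_j$. Let $\mathfrak h_0$ be a Cartan subalgebra of $\mathfrak g_0$, and let $\mathfrak b_0\supseteq\mathfrak h_0$ be a Borel subalgebra of $\mathfrak g_0$ (a maximal solvable subalgebra). For $\mu\in\mathfrak h_0^*$ let $\mathfrak g_j^{(\mu)}$ be the $\mathfrak h_0$-weight space of $\mathfrak g_j$ of weight $\mu$. Let $R_0=\{\alpha\neq 0 : \mathfrak g_0^{(\alpha)}\ne 0\}$ be the set of roots of $\mathfrak g_0$, let $\Delta_0$ be the set of simple roots determined by $\mathfrak b_0$ (the positive roots being those whose root space lies in $\mathfrak b_0$), and let $Q_0^+=\mathbb Z_{\ge 0}\Delta_0$. On pairs $(\mu,j)\in\mathfrak h_0^*\times\mathbb Z_n$, which are added componentwise, write $$(\mu_1,j_1)\preccurlyeq_0(\mu_2,j_2)\iff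 j_1=j_2\ \text{ and }\ \mu_2-\mu_1\in Q_0^+ .$$ Let $\Sigma_+=\{(\mu,j) : j\neq 0,\ \mu\ne 0,\ \mathfrak g_j^{(\mu)}\neq 0\}$. A highest weight of $\mathfrak g_j$ is a weight of a non-zero $\mathfrak h_0$-weight vector of $\mathfrak g_j$ annihilated by all positive root vectors of $\mathfrak g_0$; a highest root of $\mathfrak g_0$ is a root that is maximal in $R_0$ (where $\alpha\le\beta$ means $\beta-\alpha\in Q_0^+$), i.e. the highest root of one of the simple ideals of $\mathfrak g_0$. For an integer $k\ge 0$, a *$k$-nilpotent positively-graded $\mathfrak b_0$-module subalgebra* is a subspace $\mathfrak i\subseteq\mathfrak g_+$ with $[\mathfrak i,\mathfrak i]\subseteq\mathfrak i$, $[\mathfrak b_0,\mathfrak i]\subseteq\mathfrak i$, $(\operatorname{ad}\mathfrak i)^k(\mathfrak i)=0$ (that is, $[x_1,[x_2,\dots,[x_k,y]\dots]]=0$ for all $x_1,\dots,x_k,y\in\mathfrak i$) and $\mathfrak i=\bigoplus_{j\ne0}(\mathfrak i\cap\mathfrak g_j)$. Its set of graded weights is $\{(\mu,j) : \mathfrak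 i\cap\mathfrak g_j^{(\mu)}\ne 0\}$, and $\mathcal A_{\mathfrak i}$ denotes the set of $\preccurlyeq_0$-minimal elements of this set. A subset $\mathcal A\subseteq\Sigma_+$ *generates* $\mathfrak i$ if $\mathcal A=\mathcal A_{\mathfrak i}$. **Theorem.** Let $k\ge 0$ and let $\mathcal A\subseteq\Sigma_+$ be an antichain for $\preccurlyeq_0$. Then $\mathcal A$ generates some $k$-nilpotent positively-graded $\mathfrak b_0$-module subalgebra if and only if the following three conditions hold: (i) For any (not necessarily distinct) $(\mu_1,j_1),\dots,(\mu_{k+1},j_{k+1})\in\mathcal A$ and any highest weight $\lambda$ of $\mathfrak g_{j_1+\dots+j_{k+1}}$, $$(\mu_1,j_1)+\dots+(\mu_{k+1},j_{k+1})\not\preccurlyeq_0(\lambda,j_1+\dots+j_{k+1}).$$ (ii) For any $m\ge 1$, any (not necessarily distinct) $(\mu_1,j_1),\dots,(\mu_m,j_m)\in\mathcal A$ with $j_1+\dots+j_m=0$ in $\mathbb Z_n$, and any highest root $\theta$ of $\mathfrak g_0$, $$(\mu_1,j_1)+\dots+(\mu_m,j_m)\not\preccurlyeq_0(\theta,0).$$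 (iii) If $(\mu_1,j_1),(\mu_2,j_2)\in\mathcal A$ and $(\mu_1,j_1)+(\mu_2,j_2)\preccurlyeq_0(\nu,j_1+j_2)$ for some $(\nu,j_1+j_2)\in\Sigma_+$, then there exists $(\alpha,j_1+j_2)\in\mathcal A$ such that $(\alpha,j_1+j_2)\preccurlyeq_0(\nu,j_1+j_2)$. -/

import Mathlib

open Module

namespace ZModGraded

variable {n : ℕ} {g : Type*} [LieRing g] [LieAlgebra ℂ g]
  (Γ : ZMod n → Submodule ℂ g) [GradedLieAlgebra Γ]

/-- The Lie subalgebra `g_0` of a `ℤ/n`-graded Lie algebra `g` with components `g_j = Γ j`. -/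
def zero : LieSubalgebra ℂ g :=
  { Γ 0 with
    lie_mem' := fun {x y} hx hy => by
      have h := SetLike.GradedBracket.bracket_mem (ℒ := Γ) (i := 0) (j := 0)
        (gi := x) (gj := y) hx hy
      rwa [add_zero] at h }

/-- `g_+`, the sum of the graded components of non-zero degree. -/
def plus : Submodule ℂ g := ⨆ j : {j : ZMod n // j ≠ 0}, Γ j

/-- A Borel subalgebra of `g_0`: a maximal solvable subalgebra. -/
def IsBorel (b : LieSubalgebra ℂ (zero Γ)) : Prop :=
  Maximal (fun c : LieSubalgebra ℂ (zero Γ) => LieAlgebra.IsSolvable c) b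

variable (h : LieSubalgebra ℂ (zero Γ)) (b : LieSubalgebra ℂ (zero Γ))

/-- The `h_0`-weight space of weight `μ ∈ h_0^*` in the component `g_j`. -/
def weightSpace (μ : Dual ℂ h) (j : ZMod n) : Submodule ℂ g where
  carrier := {x | x ∈ Γ j ∧ ∀ t : h, ⁅((t : zero Γ) : g), x⁆ = μ t • x}
  add_mem' := fun {x y} hx hy =>
    ⟨add_mem hx.1 hy.1, fun t => by rw [lie_add, hx.2 t, hy.2 t, smul_add]⟩
  zero_mem' := ⟨zero_mem _, fun t => by rw [lie_zero, smul_zero]⟩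
  smul_mem' := fun c x hx =>
    ⟨Submodule.smul_mem _ c hx.1, fun t => by rw [lie_smul, hx.2 t, smul_comm]⟩

/-- The set of graded `h_0`-weights of a subspace `i` of `g`: the pairs `(μ, j)` such that `μ` is a
weight of `i ∩ g_j`. -/
def grwt (i : Submodule ℂ g) : Set (Dual ℂ h × ZMod n) :=
  {p | ∃ x ∈ i, x ∈ weightSpace Γ h p.1 p.2 ∧ x ≠ 0}

/-- The set `Σ_+` of graded weights of `g_+` with non-zero weight. -/
def sigmaPlus : Set (Dual ℂ h × ZMod n) :=
  {p | weightSpace Γ h p.1 p.2 ≠ ⊥ ∧ p.1 ≠ 0 ∧ p.2 ≠ 0}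

/-- The roots of `g_0`: the non-zero `h_0`-weights of `g_0`. -/
def roots : Set (Dual ℂ h) := {α | weightSpace Γ h α 0 ≠ ⊥ ∧ α ≠ 0}

/-- The positive roots of `g_0` with respect to `b_0`: those whose root space lies in `b_0`. -/
def posRoots : Set (Dual ℂ h) :=
  {α | α ∈ roots Γ h ∧ ∀ x : zero Γ, (x : g) ∈ weightSpace Γ h α 0 → x ∈ b}

/-- The simple roots of `g_0` with respect to `b_0`: the positive roots which are not the sum of
two positive roots. -/
def simpleRoots : Set (Dual ℂ h) :=
  {α | α ∈ posRoots Γ h b ∧ ∀ β ∈ posRoots Γ h b, ∀ γ ∈ posRoots Γ h b, α ≠ β + γ}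

/-- `Q_0^+`, the non-negative integral span of the simple roots of `g_0`. -/
def rootCone : AddSubmonoid (Dual ℂ h) := AddSubmonoid.closure (simpleRoots Γ h b)

/-- The order on graded weights: `(ν, i) ≼ (μ, j)` iff `i = j` and `μ - ν ∈ Q_0^+`. -/
def GLE (p q : Dual ℂ h × ZMod n) : Prop := p.2 = q.2 ∧ q.1 - p.1 ∈ rootCone Γ h b

/-- `l` is a highest weight of the `g_0`-module `g_j`: there is a non-zero vector of weight `l` in
`g_j` annihilated by all positive root vectors of `g_0`. -/
def IsHighestWeight (l : Dual ℂ h) (j : ZMod n) : Prop :=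
  ∃ v ∈ weightSpace Γ h l j, v ≠ 0 ∧
    ∀ α ∈ posRoots Γ h b, ∀ e ∈ weightSpace Γ h α 0, ⁅e, v⁆ = 0

/-- `θ` is a highest root of `g_0` (the highest root of one of its simple ideals): a root which is
maximal among the roots of `g_0`, where `α ≤ β` means `β - α ∈ Q_0^+`. -/
def IsHighestRoot (θ : Dual ℂ h) : Prop :=
  θ ∈ roots Γ h ∧ ∀ α ∈ roots Γ h, α - θ ∈ rootCone Γ h b → α = θ

/-- `i ⊆ g_+` is a `k`-nilpotent positively-graded `b_0`-module subalgebra. -/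
structure IsNilpotentGradedSubalgebra (k : ℕ) (i : Submodule ℂ g) : Prop where
  le_plus : i ≤ plus Γ
  lie_mem : ∀ x ∈ i, ∀ y ∈ i, ⁅x, y⁆ ∈ i
  borel_lie_mem : ∀ x ∈ b, ∀ y ∈ i, ⁅(x : g), y⁆ ∈ i
  /-- `(ad i)^k (i) = 0`: all `[x_1, [x_2, … [x_k, y] … ]]` with `x_1, …, x_k, y ∈ i` vanish. -/
  nilpotent : ∀ l : List g, l.length = k → (∀ x ∈ l, x ∈ i) →
    ∀ y ∈ i, l.foldr (fun x z => ⁅x, z⁆) y = 0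
  /-- `i` is the sum, automatically direct, of the `i ∩ g_j` with `j ≠ 0`. -/
  graded : i = ⨆ j : {j : ZMod n // j ≠ 0}, i ⊓ Γ j

/-- The set `A_i` of minimal graded weights of `i`. -/
def minWeights (i : Submodule ℂ g) : Set (Dual ℂ h × ZMod n) :=
  {p | p ∈ grwt Γ h i ∧ ∀ q ∈ grwt Γ h i, GLE Γ h b q p → q = p}

/-- `A` generates a `k`-nilpotent positively-graded `b_0`-module subalgebra, i.e. `A = A_i` for some
such subalgebra `i`. -/
def Generates (k : ℕ) (A : Set (Dual ℂ h × ZMod n)) : Prop :=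
  ∃ i : Submodule ℂ g, IsNilpotentGradedSubalgebra Γ b k i ∧ A = minWeights Γ h b i

end ZModGraded

/-!
The weights `(μ, j)` of `g` with `μ ≠ 0` behave like the real roots of an affine root system,
although the Cartan subalgebra `h_0` of `g_0` need not be a Cartan subalgebra of `g`. As the Killing
form is non-degenerate on `h_0` and `ad h_0` is diagonalizable, each such weight belongs to an
`sl₂`-triple, has positive length and has multiplicity one (`isRootGrading`). All consequences for
root strings are drawn from a single identity: along a string stable under `e` and `f`, the trace
of `[e, f]` on each member is a difference of consecutive traces of `f e`
(`IsString.finrank_mul`). Thus no representation theory of `sl₂` and no lift to the loop algebra is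
needed.

The combinatorial core is `IsRootGrading.sum_mem_filtration`: for a filtration by subspaces
compatible with the bracket which does not contain opposite real roots, if a sum of real weights of
levels `l_1, …, l_m` is again a weight, then its root space has level `l_1 + ⋯ + l_m`. Two
weights of negative inner product may be merged into their sum, and if there are none, then each
weight may be split off from the total sum.

For the necessity of the three conditions this is applied to the filtration with `b_0` in level
zero and the `l`-th power of `i` in level `l` (`gr_le_filtration`): a weight above a sum of `m`
weights of `i` is a sum of these weights and of simple roots of `g_0`, so its weight space lies in
the `m`-th power of `i`. This is zero for `m = k + 1`, has no part of degree zero, and lies in `i`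
for `m = 2`. Opposite roots are excluded since they would give non-zero brackets of arbitrary length
in `i` (`IsRootGrading.add_ne_zero_of_nilpotent`) or a perfect subalgebra of `b_0`
(`add_ne_zero_of_solvable`).

For the sufficiency, `i` is the sum of the weight spaces of non-zero degree whose weight lies above
an element of `A` (`generated`). Condition (i) bounds the length of non-zero brackets, (ii) excludes
brackets of degree zero and (iii) puts the brackets of non-zero weight into `i`. What remains are
the brackets of weight zero. If `(μ, j)` and `(-μ, j')` with `μ ≠ 0` are weights of `i`, then, by
reflection, all `(μ, j) + s (0, j + j')` and `(s + 1) (0, j + j')` are weights of `g`, and these lie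
above sums of arbitrarily many elements of `A`, against (i) (`fst_ne_neg_fst`). If both factors have
weight zero, they lie in the centralizer of `h_0`, which is abelian (`lie_eq_zero_of_weight_zero`):
by Kreknin's theorem (`eq_bot_of_perfect`) it is solvable, and its brackets are then `ad`-nilpotent
and orthogonal to everything.
-/

open Module

namespace ZModGraded

/-! ### Traces along strings -/

section StringTrace

variable {g : Type*} [LieRing g] [LieAlgebra ℂ g]

/-- A string for the pair `e`, `f`: a family of subspaces `N m`, `m ∈ ℤ`, raised by `ad e` and
lowered by `ad f`, such that `[e, f]` acts on `N m` by the scalar `χ m`. -/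
structure IsString (e f : g) (N : ℤ → Submodule ℂ g) (χ : ℤ → ℂ) : Prop where
  raise : ∀ m, ∀ x ∈ N m, ⁅e, x⁆ ∈ N (m + 1)
  lower : ∀ m, ∀ x ∈ N (m + 1), ⁅f, x⁆ ∈ N m
  scalar : ∀ m, ∀ x ∈ N m, ⁅⁅e, f⁆, x⁆ = χ m • x

namespace IsString

variable {e f : g} {N : ℤ → Submodule ℂ g} {χ : ℤ → ℂ}

/-- The raising map `N m → N (m + 1)`. -/
def up (hN : IsString e f N χ) (m : ℤ) : N m →ₗ[ℂ] N (m + 1) :=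
  (LieAlgebra.ad ℂ g e).restrict (hN.raise m)

/-- The lowering map `N (m + 1) → N m`. -/
def down (hN : IsString e f N χ) (m : ℤ) : N (m + 1) →ₗ[ℂ] N m :=
  (LieAlgebra.ad ℂ g f).restrict (hN.lower m)

/-- The trace of `ad f ∘ ad e` on `N m`. -/
noncomputable def tr (hN : IsString e f N χ) (m : ℤ) : ℂ :=
  LinearMap.trace ℂ _ (hN.down m ∘ₗ hN.up m)

lemma tr_eq_zero (hN : IsString e f N χ) {m : ℤ} (h : ∀ x ∈ N m, ⁅e, x⁆ = 0) : hN.tr m = 0 := by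
  have : hN.up m = 0 := by
    ext x
    exact h x x.2
  rw [tr, this, LinearMap.comp_zero, map_zero]

variable [FiniteDimensional ℂ g]

/-- Since `[e, f] = e f - f e`, the trace of `[e, f]` on one member of a string is a difference of
two consecutive traces of `f e`. -/
lemma finrank_mul (hN : IsString e f N χ) (m : ℤ) :
    (finrank ℂ (N (m + 1)) : ℂ) * χ (m + 1) = hN.tr m - hN.tr (m + 1) := by
  have h : χ (m + 1) • (LinearMap.id : N (m + 1) →ₗ[ℂ] N (m + 1)) =
      hN.up m ∘ₗ hN.down m - hN.down (m + 1) ∘ₗ hN.up (m + 1) := by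
    ext x
    have := hN.scalar (m + 1) x x.2
    rw [lie_lie] at this
    exact this.symm
  have h2 := congrArg (LinearMap.trace ℂ _) h
  rw [map_smul, map_sub, LinearMap.trace_id, LinearMap.trace_comp_comm', smul_eq_mul] at h2
  rw [mul_comm, h2]
  rfl

lemma sum_range (hN : IsString e f N χ) (a : ℤ) (k : ℕ) :
    ∑ i ∈ Finset.range k, (finrank ℂ (N (a + i + 1)) : ℂ) * χ (a + i + 1) =
      hN.tr a - hN.tr (a + k) := by
  induction k with
  | zero => simp
  | succ k ih =>
    rw [Finset.sum_range_succ, ih, hN.finrank_mul]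
    push_cast
    rw [← add_assoc]
    ring

lemma sum_range_re (hN : IsString e f N χ) {a : ℤ} {k : ℕ} (ha : ∀ x ∈ N a, ⁅e, x⁆ = 0)
    (hk : ∀ x ∈ N (a + k), ⁅e, x⁆ = 0) :
    ∑ i ∈ Finset.range k, (finrank ℂ (N (a + i + 1)) : ℝ) * (χ (a + i + 1)).re = 0 := by
  have h := congrArg Complex.re (hN.sum_range a k)
  rw [hN.tr_eq_zero ha, hN.tr_eq_zero hk] at h
  simpa using h

/-- A string ending at `b`, with no member below `a`, on which `[e, f]` has only non-positive
eigenvalues, has only the eigenvalue `0`. -/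
lemma false_of_neg (hN : IsString e f N χ) {a b : ℤ} (ha : ∀ m ≤ a, N m = ⊥)
    (hb : ∀ x ∈ N b, ⁅e, x⁆ = 0) (hle : ∀ m ≤ b, N m ≠ ⊥ → (χ m).re ≤ 0)
    {m : ℤ} (hmb : m ≤ b) (hm : N m ≠ ⊥) (hneg : (χ m).re < 0) : False := by
  have ham : a < m := by
    by_contra h
    exact hm (ha m (not_lt.mp h))
  obtain ⟨k, rfl⟩ : ∃ k : ℕ, b = a + k := ⟨(b - a).toNat, by omega⟩
  have h0 : ∀ x ∈ N a, ⁅e, x⁆ = 0 := by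
    intro x hx
    rw [ha a le_rfl, Submodule.mem_bot] at hx
    rw [hx, lie_zero]
  have hs := hN.sum_range_re h0 hb
  obtain ⟨j, rfl⟩ : ∃ j : ℕ, m = a + j + 1 := ⟨(m - a - 1).toNat, by omega⟩
  have hj : j ∈ Finset.range k := by
    rw [Finset.mem_range]; omega
  have hpos : 0 < finrank ℂ (N (a + j + 1)) := by
    rw [Nat.pos_iff_ne_zero]
    exact fun h => hm (Submodule.finrank_eq_zero.mp h)
  have : ∑ i ∈ Finset.range k, (finrank ℂ (N (a + i + 1)) : ℝ) * (χ (a + i + 1)).re < 0 := by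
    refine Finset.sum_neg' (fun i hi => ?_)
      ⟨j, hj, mul_neg_of_pos_of_neg (by exact_mod_cast hpos) hneg⟩
    by_cases hi' : N (a + i + 1) = ⊥
    · rw [Submodule.finrank_eq_zero.mpr hi']; simp
    · refine mul_nonpos_of_nonneg_of_nonpos (by positivity) (hle _ ?_ hi')
      rw [Finset.mem_range] at hi
      omega
  exact this.ne hs

/-- A string starting after a member killed by `e`, with no member above `b`, cannot have only
positive eigenvalues of `[e, f]`. -/
lemma false_of_pos (hN : IsString e f N χ) {a b : ℤ} (ha : ∀ x ∈ N a, ⁅e, x⁆ = 0)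
    (hb : ∀ m ≥ b, N m = ⊥) (hle : ∀ m > a, N m ≠ ⊥ → 0 < (χ m).re)
    {m : ℤ} (hma : a < m) (hm : N m ≠ ⊥) : False := by
  have ham : m < b := by
    by_contra h
    exact hm (hb m (not_lt.mp h))
  obtain ⟨k, rfl⟩ : ∃ k : ℕ, b = a + k := ⟨(b - a).toNat, by omega⟩
  have h0 : ∀ x ∈ N (a + k), ⁅e, x⁆ = 0 := by
    intro x hx
    rw [hb _ le_rfl, Submodule.mem_bot] at hx
    rw [hx, lie_zero]
  have hs := hN.sum_range_re ha h0
  obtain ⟨j, rfl⟩ : ∃ j : ℕ, m = a + j + 1 := ⟨(m - a - 1).toNat, by omega⟩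
  have hj : j ∈ Finset.range k := by
    rw [Finset.mem_range]; omega
  have hpos : 0 < finrank ℂ (N (a + j + 1)) := by
    rw [Nat.pos_iff_ne_zero]
    exact fun h => hm (Submodule.finrank_eq_zero.mp h)
  have : 0 < ∑ i ∈ Finset.range k, (finrank ℂ (N (a + i + 1)) : ℝ) * (χ (a + i + 1)).re := by
    refine Finset.sum_pos' (fun i hi => ?_)
      ⟨j, hj, mul_pos (by exact_mod_cast hpos) (hle _ (by omega) hm)⟩
    by_cases hi' : N (a + i + 1) = ⊥
    · rw [Submodule.finrank_eq_zero.mpr hi']; simp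
    · exact mul_nonneg (by positivity) (hle _ (by omega) hi').le
  exact this.ne' hs

end IsString

end StringTrace

/-! ### Homogeneous components and Kreknin's theorem -/

section Homogeneous

variable {n : ℕ} {g : Type*} [LieRing g] [LieAlgebra ℂ g]
  (Γ : ZMod n → Submodule ℂ g) [GradedLieAlgebra Γ]

/-- The projection of `g` onto its component of degree `j`, as an endomorphism of `g`. -/
noncomputable def comp (j : ZMod n) : g →ₗ[ℂ] g :=
  (Γ j).subtype ∘ₗ DirectSum.component ℂ (ZMod n) (fun i => Γ i) j ∘ₗ
    (DirectSum.decomposeLinearEquiv Γ).toLinearMap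

lemma comp_apply (j : ZMod n) (x : g) : comp Γ j x = DirectSum.decompose Γ x j := rfl

lemma comp_mem (j : ZMod n) (x : g) : comp Γ j x ∈ Γ j := by
  rw [comp_apply]; exact SetLike.coe_mem _

lemma comp_of_mem {j : ZMod n} {x : g} (hx : x ∈ Γ j) : comp Γ j x = x := by
  rw [comp_apply, DirectSum.decompose_of_mem_same Γ hx]

lemma comp_of_mem_ne {i j : ZMod n} {x : g} (hx : x ∈ Γ i) (hij : i ≠ j) : comp Γ j x = 0 := by
  rw [comp_apply, DirectSum.decompose_of_mem_ne Γ hx hij]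

lemma sum_comp [NeZero n] (x : g) : ∑ j, comp Γ j x = x := by
  classical
  have := DirectSum.sum_support_decompose Γ x
  conv_rhs => rw [← this]
  symm
  refine Finset.sum_subset (Finset.subset_univ _) fun i _ hi => ?_
  rw [DFinsupp.notMem_support_iff] at hi
  rw [hi]; rfl

variable {Γ}

lemma lie_mem_component {i j : ZMod n} {x y : g} (hx : x ∈ Γ i) (hy : y ∈ Γ j) :
    ⁅x, y⁆ ∈ Γ (i + j) :=
  SetLike.GradedBracket.bracket_mem hx hy

/-- The component of degree `i + j` of `[x, y]`, for `x` homogeneous of degree `i`. -/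
lemma comp_lie [NeZero n] {i : ZMod n} {x : g} (hx : x ∈ Γ i) (k : ZMod n) (y : g) :
    comp Γ k ⁅x, y⁆ = ⁅x, comp Γ (k - i) y⁆ := by
  conv_lhs => rw [← sum_comp Γ y, lie_sum, map_sum]
  rw [Finset.sum_eq_single (k - i)]
  · have := lie_mem_component hx (comp_mem Γ (k - i) y)
    rw [add_sub_cancel] at this
    exact comp_of_mem Γ this
  · intro j _ hj
    refine comp_of_mem_ne Γ (lie_mem_component hx (comp_mem Γ j y)) fun h => hj ?_
    rw [← h, add_sub_cancel_left]
  · simp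

end Homogeneous

section Kreknin

variable {n : ℕ} [NeZero n] {g : Type*} [LieRing g] [LieAlgebra ℂ g]
  {Γ : ZMod n → Submodule ℂ g} [GradedLieAlgebra Γ]

/-- The inductive step of Kreknin's theorem: in a perfect graded subalgebra `D` with central
component of degree zero, the components of degree `0` and of degree larger than `k` generate
everything, for all `k < n`. -/
lemma le_lieSpan_of_perfect (D : LieSubalgebra ℂ g) (hD : ∀ x ∈ D, ∀ j, comp Γ j x ∈ D)
    (hperf : (D : Submodule ℂ g) ≤ Submodule.span ℂ {z | ∃ x ∈ D, ∃ y ∈ D, ⁅x, y⁆ = z})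
    (hcent : ∀ x ∈ D, x ∈ Γ 0 → ∀ y ∈ D, ⁅x, y⁆ = 0) (k : ℕ) :
    D ≤ LieSubalgebra.lieSpan ℂ g {x | x ∈ D ∧ ∃ j : ZMod n, (j = 0 ∨ k < j.val) ∧ x ∈ Γ j} := by
  induction k with
  | zero =>
    intro x hx
    rw [← sum_comp Γ x]
    refine sum_mem fun j _ => LieSubalgebra.subset_lieSpan ⟨hD x hx j, j, ?_, comp_mem Γ j x⟩
    by_cases hj : j = 0
    · exact Or.inl hj
    · exact Or.inr (Nat.pos_of_ne_zero fun h => hj ((ZMod.val_eq_zero j).mp h))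
  | succ k ih =>
    set K := LieSubalgebra.lieSpan ℂ g
      {x | x ∈ D ∧ ∃ j : ZMod n, (j = 0 ∨ k + 1 < j.val) ∧ x ∈ Γ j} with hK
    refine ih.trans (LieSubalgebra.lieSpan_le.mpr ?_)
    rintro x ⟨hxD, i, hi, hxi⟩
    by_cases hik : i = 0 ∨ k + 1 < i.val
    · exact LieSubalgebra.subset_lieSpan ⟨hxD, i, hik, hxi⟩
    have hival : i.val = k + 1 := by
      rcases hi with hi | hi
      · exact absurd (Or.inl hi) hik
      · by_contra h
        exact hik (Or.inr (by omega))
    -- The elements whose brackets with `D` have their degree `i` component in `K`.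
    let U : LieSubalgebra ℂ g :=
      { carrier := {u | u ∈ D ∧ ∀ v ∈ D, comp Γ i ⁅u, v⁆ ∈ K}
        add_mem' := fun {a b} ha hb => ⟨add_mem ha.1 hb.1, fun v hv => by
          rw [add_lie, map_add]; exact add_mem (ha.2 v hv) (hb.2 v hv)⟩
        zero_mem' := ⟨zero_mem _, fun v _ => by rw [zero_lie, map_zero]; exact zero_mem _⟩
        smul_mem' := fun c a ha => ⟨D.smul_mem c ha.1, fun v hv => by
          rw [smul_lie, map_smul]; exact K.smul_mem c (ha.2 v hv)⟩
        lie_mem' := fun {a b} ha hb => ⟨D.lie_mem ha.1 hb.1, fun v hv => by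
          rw [lie_lie, map_sub]
          exact sub_mem (ha.2 _ (D.lie_mem hb.1 hv)) (hb.2 _ (D.lie_mem ha.1 hv))⟩ }
    have hU : D ≤ U := by
      refine ih.trans (LieSubalgebra.lieSpan_le.mpr ?_)
      rintro u ⟨huD, c, hc, huc⟩
      refine ⟨huD, fun v hv => ?_⟩
      rw [comp_lie huc]
      have hw := hD v hv (i - c)
      have hw' := comp_mem Γ (i - c) v
      set w := comp Γ (i - c) v
      rcases hc with rfl | hc
      · rw [hcent u huD huc w hw]; exact zero_mem _
      by_cases hci : c = i
      · subst hci
        rw [sub_self] at hw'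
        rw [← lie_skew, hcent w hw hw' u huD, neg_zero]; exact zero_mem _
      have hcval : k + 1 < c.val := by
        have : c.val ≠ i.val := fun h => hci (ZMod.val_injective n h)
        omega
      have hcn := ZMod.val_lt c
      have hdval : k + 1 < (i - c).val := by
        have h1 : ((i - c) + c).val = i.val := by rw [sub_add_cancel]
        rw [ZMod.val_add] at h1
        have h2 := ZMod.val_lt (i - c)
        rcases lt_or_ge ((i - c).val + c.val) n with h | h
        · rw [Nat.mod_eq_of_lt h] at h1; omega
        · rw [Nat.mod_eq_sub_mod h, Nat.mod_eq_of_lt (by omega)] at h1; omega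
      exact K.lie_mem (LieSubalgebra.subset_lieSpan ⟨huD, c, Or.inr hcval, huc⟩)
        (LieSubalgebra.subset_lieSpan ⟨hw, i - c, Or.inr hdval, hw'⟩)
    have hx : x ∈ K.toSubmodule.comap (comp Γ i) := by
      refine Submodule.span_le.mpr ?_ (hperf hxD)
      rintro _ ⟨u, hu, v, hv, rfl⟩
      exact (hU hu).2 v hv
    rw [Submodule.mem_comap, comp_of_mem Γ hxi] at hx
    exact hx

/-- A version of Kreknin's theorem: a perfect `ℤ/n`-graded Lie algebra whose component of degree
zero is central vanishes. -/
theorem eq_bot_of_perfect (D : LieSubalgebra ℂ g) (hD : ∀ x ∈ D, ∀ j, comp Γ j x ∈ D)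
    (hperf : (D : Submodule ℂ g) ≤ Submodule.span ℂ {z | ∃ x ∈ D, ∃ y ∈ D, ⁅x, y⁆ = z})
    (hcent : ∀ x ∈ D, x ∈ Γ 0 → ∀ y ∈ D, ⁅x, y⁆ = 0) {x : g} (hx : x ∈ D) : x = 0 := by
  let U : LieSubalgebra ℂ g :=
    { carrier := {u | u ∈ D ∧ ∀ v ∈ D, ⁅u, v⁆ = 0}
      add_mem' := fun {a b} ha hb => ⟨add_mem ha.1 hb.1, fun v hv => by
        rw [add_lie, ha.2 v hv, hb.2 v hv, add_zero]⟩
      zero_mem' := ⟨zero_mem _, fun v _ => zero_lie v⟩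
      smul_mem' := fun c a ha => ⟨D.smul_mem c ha.1, fun v hv => by
        rw [smul_lie, ha.2 v hv, smul_zero]⟩
      lie_mem' := fun {a b} ha hb => ⟨D.lie_mem ha.1 hb.1, fun v hv => by
        rw [lie_lie, ha.2 _ (D.lie_mem hb.1 hv), hb.2 _ (D.lie_mem ha.1 hv), sub_zero]⟩ }
  have hU : D ≤ U := by
    refine (le_lieSpan_of_perfect D hD hperf hcent n).trans (LieSubalgebra.lieSpan_le.mpr ?_)
    rintro u ⟨huD, j, hj, huj⟩
    rcases hj with rfl | hj
    · exact ⟨huD, hcent u huD huj⟩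
    · exact absurd (ZMod.val_lt j) (by omega)
  have h0 : Submodule.span ℂ {z | ∃ x ∈ D, ∃ y ∈ D, ⁅x, y⁆ = z} ≤ ⊥ := by
    refine Submodule.span_le.mpr ?_
    rintro _ ⟨u, hu, v, hv, rfl⟩
    exact (hU hu).2 v hv
  exact (Submodule.mem_bot ℂ).mp (h0 (hperf hx))

end Kreknin

/-! ### The Killing form and the Cartan subalgebra of `g_0` -/

section Killing

variable {n : ℕ} {g : Type*} [LieRing g] [LieAlgebra ℂ g]
  {Γ : ZMod n → Submodule ℂ g} [GradedLieAlgebra Γ] {h : LieSubalgebra ℂ (zero Γ)}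

lemma mem_zero (t : zero Γ) : (t : g) ∈ Γ 0 := t.2

/-- An element of `g_0` commuting with the Cartan subalgebra lies in it. -/
lemma mem_cartan (hh : h.IsCartanSubalgebra) {x : g} (hx : x ∈ Γ 0)
    (hcomm : ∀ t : h, ⁅((t : zero Γ) : g), x⁆ = 0) : ∃ s : h, ((s : zero Γ) : g) = x := by
  have : (⟨x, hx⟩ : zero Γ) ∈ h.normalizer := by
    rw [LieSubalgebra.mem_normalizer_iff']
    intro y hy
    have : ⁅y, (⟨x, hx⟩ : zero Γ)⁆ = 0 := Subtype.ext (hcomm ⟨y, hy⟩)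
    rw [this]; exact zero_mem _
  rw [hh.self_normalizing] at this
  exact ⟨⟨_, this⟩, rfl⟩

lemma killingForm_lie (x y z : g) : killingForm ℂ g ⁅x, y⁆ z = killingForm ℂ g x ⁅y, z⁆ :=
  LieModule.traceForm_apply_lie_apply ℂ g g x y z

lemma eq_zero_of_killingForm [LieAlgebra.IsKilling ℂ g] {x : g}
    (hx : ∀ y, killingForm ℂ g x y = 0) : x = 0 := by
  have : x ∈ LinearMap.ker (killingForm ℂ g) := by
    rw [LinearMap.mem_ker]; ext y; exact hx y
  rwa [LieAlgebra.IsKilling.ker_killingForm_eq_bot, Submodule.mem_bot] at this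

lemma eq_zero_of_lie [LieAlgebra.IsKilling ℂ g] {x : g} (hx : ∀ y : g, ⁅x, y⁆ = 0) : x = 0 := by
  refine eq_zero_of_killingForm fun y => ?_
  rw [killingForm_apply_apply]
  have : LieAlgebra.ad ℂ g x = 0 := by ext y; exact hx y
  rw [this, LinearMap.zero_comp, map_zero]

variable [FiniteDimensional ℂ g]

lemma killingForm_of_add_ne_zero {i j : ZMod n} {x y : g} (hx : x ∈ Γ i) (hy : y ∈ Γ j)
    (hij : i + j ≠ 0) : killingForm ℂ g x y = 0 := by
  refine LinearMap.trace_eq_zero_of_mapsTo_ne (DirectSum.Decomposition.isInternal Γ)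
    (fun k => i + (j + k)) (fun k h => hij ?_) (fun k z hz => ?_)
  · rwa [← add_assoc, add_eq_right] at h
  · exact lie_mem_component hx (lie_mem_component hy hz)

variable [NeZero n]

lemma eq_zero_of_forall_component [LieAlgebra.IsKilling ℂ g] {i : ZMod n} {x : g} (hx : x ∈ Γ i)
    (h : ∀ y ∈ Γ (-i), killingForm ℂ g x y = 0) : x = 0 := by
  refine eq_zero_of_killingForm fun y => ?_
  rw [← sum_comp Γ y, map_sum]
  refine Finset.sum_eq_zero fun j _ => ?_
  by_cases hj : i + j = 0
  · rw [← neg_eq_of_add_eq_zero_right hj]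
    exact h _ (comp_mem Γ _ y)
  · exact killingForm_of_add_ne_zero hx (comp_mem Γ j y) hj

/-- The Killing form of `g` is non-degenerate on a Cartan subalgebra of `g_0`, because the Fitting
complement of this subalgebra in `g_0` is orthogonal to it. -/
lemma eq_zero_of_forall_cartan [LieAlgebra.IsKilling ℂ g] (hh : h.IsCartanSubalgebra) (s : h)
    (hs : ∀ t : h, killingForm ℂ g ((s : zero Γ) : g) ((t : zero Γ) : g) = 0) : s = 0 := by
  have : LieRing.IsNilpotent h := hh.nilpotent
  have hcod := (LieModule.isCompl_genWeightSpace_zero_posFittingComp ℂ h (zero Γ)).sup_eq_top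
  suffices h0 : ((s : zero Γ) : g) = 0 by
    exact Subtype.ext (Subtype.ext h0)
  refine eq_zero_of_forall_component (Γ := Γ) (mem_zero _) fun y hy => ?_
  rw [neg_zero] at hy
  have hy' : (⟨y, hy⟩ : zero Γ) ∈ LieModule.genWeightSpace (zero Γ) (0 : h → ℂ) ⊔
      LieModule.posFittingComp ℂ h (zero Γ) := by rw [hcod]; trivial
  obtain ⟨a, ha, c, hc, hac⟩ := (LieSubmodule.mem_sup _ _ _).mp hy'
  have hroot := LieAlgebra.rootSpace_zero_eq ℂ (zero Γ) h
  have ha' : a ∈ h := by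
    have : a ∈ LieAlgebra.rootSpace h 0 := ha
    rw [hroot] at this; exact this
  have hs' : (s : zero Γ) ∈ LieModule.genWeightSpace (zero Γ) (0 : h → ℂ) := by
    change (s : zero Γ) ∈ LieAlgebra.rootSpace h 0
    rw [hroot]; exact s.2
  have hyac : y = (a : g) + (c : g) := congrArg Subtype.val hac.symm
  rw [hyac, map_add, hs ⟨a, ha'⟩, zero_add]
  let B : LinearMap.BilinForm ℂ (zero Γ) :=
    (killingForm ℂ g).compl₁₂ (zero Γ).toSubmodule.subtype (zero Γ).toSubmodule.subtype
  refine LieModule.eq_zero_of_mem_genWeightSpace_mem_posFitting ℂ h (zero Γ) (B := B) ?_ hs' hc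
  intro t u v
  change killingForm ℂ g ⁅((t : zero Γ) : g), (u : g)⁆ (v : g) =
    -killingForm ℂ g (u : g) ⁅((t : zero Γ) : g), (v : g)⁆
  rw [← lie_skew, map_neg, LinearMap.neg_apply, killingForm_lie]

lemma isLieAbelian_cartan [LieAlgebra.IsKilling ℂ g] (hh : h.IsCartanSubalgebra) :
    IsLieAbelian h := by
  have : LieRing.IsNilpotent h := hh.nilpotent
  refine LieModule.isLieAbelian_of_ker_traceForm_eq_bot ℂ h g ?_
  rw [eq_bot_iff]
  intro s hs
  rw [Submodule.mem_bot]
  refine eq_zero_of_forall_cartan hh s fun t => ?_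
  exact LinearMap.congr_fun (LinearMap.mem_ker.mp hs) t

lemma lie_cartan [LieAlgebra.IsKilling ℂ g] (hh : h.IsCartanSubalgebra) (s t : h) :
    ⁅((s : zero Γ) : g), ((t : zero Γ) : g)⁆ = 0 := by
  have := isLieAbelian_cartan hh
  have h1 : ⁅s, t⁆ = 0 := LieModule.IsTrivial.trivial s t
  exact congrArg (fun x : h => ((x : zero Γ) : g)) h1

end Killing

/-! ### The decomposition into graded weight spaces -/

section Jordan

variable {g : Type*} [LieRing g] [LieAlgebra ℂ g] [FiniteDimensional ℂ g]

open Module.End in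
/-- The semisimple part of `ad x` is inner; it acts on each generalized eigenspace of `ad x` by the
corresponding eigenvalue. -/
lemma exists_semisimple_part [LieAlgebra.IsKilling ℂ g] (x : g) :
    ∃ s : g, (LieAlgebra.ad ℂ g s).IsSemisimple ∧
      IsNilpotent (LieAlgebra.ad ℂ g x - LieAlgebra.ad ℂ g s) ∧
      ∀ (a : ℂ) (y : g), y ∈ (LieAlgebra.ad ℂ g x).maxGenEigenspace a → ⁅s, y⁆ = a • y := by
  obtain ⟨N, -, S, hS₀, hN, hS, hSN⟩ := (LieAlgebra.ad ℂ g x).exists_isNilpotent_isSemisimple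
  replace hS₀ : Commute (LieAlgebra.ad ℂ g x) S := Algebra.commute_of_mem_adjoin_self hS₀
  rw [eq_sub_of_add_eq hSN.symm] at hN
  have aux {a : ℂ} {y : g} (hy : y ∈ (LieAlgebra.ad ℂ g x).maxGenEigenspace a) : S y = a • y :=
    apply_eq_of_mem_of_comm_of_isFinitelySemisimple_of_isNil hy hS₀ hS.isFinitelySemisimple hN
  have htop := iSup_maxGenEigenspace_eq_top (LieAlgebra.ad ℂ g x)
  have h_der (y z : g) : S ⁅y, z⁆ = ⁅S y, z⁆ + ⁅y, S z⁆ := by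
    have hy : y ∈ ⨆ a : ℂ, (LieAlgebra.ad ℂ g x).maxGenEigenspace a := by rw [htop]; trivial
    have hz : z ∈ ⨆ a : ℂ, (LieAlgebra.ad ℂ g x).maxGenEigenspace a := by rw [htop]; trivial
    induction hy using Submodule.iSup_induction' with
    | mem a y hy =>
      induction hz using Submodule.iSup_induction' with
      | mem c z hz =>
        have hyz : ⁅y, z⁆ ∈ (LieAlgebra.ad ℂ g x).maxGenEigenspace (a + c) :=
          LieModule.lie_mem_maxGenEigenspace_toEnd hy hz
        rw [aux hy, aux hz, aux hyz, smul_lie, lie_smul, ← add_smul]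
      | zero => simp
      | add _ _ _ _ h h' => simp only [lie_add, map_add, h, h']; abel
    | zero => simp
    | add _ _ _ _ h h' => simp only [add_lie, map_add, h, h']; abel
  replace h_der : ∀ y z : g, S ⁅y, z⁆ = ⁅y, S z⁆ - ⁅z, S y⁆ := by
    simp_rw [← lie_skew (S _) _, add_comm, ← sub_eq_add_neg] at h_der; assumption
  let S' : LieDerivation ℂ g g := ⟨S, h_der⟩
  obtain ⟨s, hs⟩ := LieDerivation.IsKilling.exists_eq_ad S'
  have hs' : LieAlgebra.ad ℂ g s = S := by
    rw [← LieDerivation.coe_ad_apply_eq_ad_apply s, hs]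
  refine ⟨s, hs' ▸ hS, hs' ▸ hN, fun a y hy => ?_⟩
  rw [← aux hy, ← hs', LieAlgebra.ad_apply]

/-- If `z = [x, y]` commutes with `y` and with `[z, x]`, then `ad z` is nilpotent: the generalized
eigenspaces of `ad z` are stable under `x` and `y`, so `ad z` has trace zero on each of them. -/
lemma isNilpotent_ad_lie {x y : g} (hx : ⁅⁅x, y⁆, ⁅⁅x, y⁆, x⁆⁆ = 0) (hy : ⁅⁅x, y⁆, y⁆ = 0) :
    IsNilpotent (LieAlgebra.ad ℂ g ⁅x, y⁆) := by
  set z := ⁅x, y⁆ with hz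
  have hx0 : x ∈ (LieAlgebra.ad ℂ g z).maxGenEigenspace 0 := by
    rw [Module.End.mem_maxGenEigenspace]
    exact ⟨2, by simpa [pow_two] using hx⟩
  have hy0 : y ∈ (LieAlgebra.ad ℂ g z).maxGenEigenspace 0 := by
    rw [Module.End.mem_maxGenEigenspace]
    exact ⟨1, by simpa using hy⟩
  have hzero : ∀ a : ℂ, a ≠ 0 → (LieAlgebra.ad ℂ g z).maxGenEigenspace a = ⊥ := by
    intro a ha
    set W := (LieAlgebra.ad ℂ g z).maxGenEigenspace a with hW
    have hxW : ∀ w ∈ W, LieAlgebra.ad ℂ g x w ∈ W := fun w hw => by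
      have := LieModule.lie_mem_maxGenEigenspace_toEnd (R := ℂ) (L := g) (M := g) hx0 hw
      rwa [zero_add] at this
    have hyW : ∀ w ∈ W, LieAlgebra.ad ℂ g y w ∈ W := fun w hw => by
      have := LieModule.lie_mem_maxGenEigenspace_toEnd (R := ℂ) (L := g) (M := g) hy0 hw
      rwa [zero_add] at this
    have hzW : ∀ w ∈ W, LieAlgebra.ad ℂ g z w ∈ W :=
      (LieAlgebra.ad ℂ g z).mapsTo_maxGenEigenspace_of_comm rfl a
    have h1 : (LieAlgebra.ad ℂ g z).restrict hzW =
        (LieAlgebra.ad ℂ g x).restrict hxW ∘ₗ (LieAlgebra.ad ℂ g y).restrict hyW -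
        (LieAlgebra.ad ℂ g y).restrict hyW ∘ₗ (LieAlgebra.ad ℂ g x).restrict hxW := by
      ext w
      simp [hz, LieAlgebra.ad_apply]
    have h2 : LinearMap.trace ℂ W ((LieAlgebra.ad ℂ g z).restrict hzW) = 0 := by
      rw [h1, map_sub, LinearMap.trace_comp_comm', sub_self]
    have h3 : IsNilpotent ((LieAlgebra.ad ℂ g z).restrict hzW - algebraMap ℂ (Module.End ℂ W) a) :=
      (LieAlgebra.ad ℂ g z).isNilpotent_restrict_maxGenEigenspace_sub_algebraMap a
    have h4 := (LinearMap.isNilpotent_trace_of_isNilpotent h3).eq_zero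
    have h5 : LinearMap.trace ℂ W (algebraMap ℂ (Module.End ℂ W) a) = a * finrank ℂ W := by
      rw [Algebra.algebraMap_eq_smul_one, map_smul, LinearMap.trace_one, smul_eq_mul]
    rw [map_sub] at h4
    have h6 : a * (finrank ℂ W : ℂ) = 0 := by
      rw [← h5, ← sub_eq_zero.mp h4]
      exact h2
    rw [← Submodule.finrank_eq_zero (R := ℂ)]
    simpa [ha] using h6
  have htop := Module.End.iSup_maxGenEigenspace_eq_top (LieAlgebra.ad ℂ g z)
  have htop0 : (LieAlgebra.ad ℂ g z).maxGenEigenspace 0 = ⊤ := by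
    rw [← htop]
    refine le_antisymm (le_iSup _ _) (iSup_le fun a => ?_)
    by_cases ha : a = 0
    · rw [ha]
    · rw [hzero a ha]; exact bot_le
  refine ⟨finrank ℂ g, ?_⟩
  ext w
  have hw : w ∈ (LieAlgebra.ad ℂ g z).maxGenEigenspace 0 := by rw [htop0]; trivial
  rw [Module.End.maxGenEigenspace_eq_genEigenspace_finrank, Module.End.mem_genEigenspace_nat] at hw
  simpa using hw

end Jordan

section Weights

lemma commute_ad {g : Type*} [LieRing g] [LieAlgebra ℂ g] {x y : g} (hxy : ⁅x, y⁆ = 0) :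
    Commute (LieAlgebra.ad ℂ g x) (LieAlgebra.ad ℂ g y) := by
  ext w
  change ⁅x, ⁅y, w⁆⁆ = ⁅y, ⁅x, w⁆⁆
  rw [leibniz_lie, hxy, zero_lie, zero_add]

variable {n : ℕ} {g : Type*} [LieRing g] [LieAlgebra ℂ g]
  {Γ : ZMod n → Submodule ℂ g} [GradedLieAlgebra Γ] {h : LieSubalgebra ℂ (zero Γ)}

/-- If a subspace `N` is stable under the Cartan subalgebra, then it contains the components of
distinct weights of each of its elements. -/
lemma mem_of_sum_mem {N : Submodule ℂ g} (hN : ∀ t : h, ∀ x ∈ N, ⁅((t : zero Γ) : g), x⁆ ∈ N)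
    (s : Finset (Dual ℂ h)) (v : Dual ℂ h → g)
    (hv : ∀ μ ∈ s, ∀ t : h, ⁅((t : zero Γ) : g), v μ⁆ = μ t • v μ) (hs : ∑ μ ∈ s, v μ ∈ N) :
    ∀ μ ∈ s, v μ ∈ N := by
  classical
  induction s using Finset.induction_on generalizing v with
  | empty => simp
  | insert ν s hν ih =>
    have key : ∀ μ ∈ s, v μ ∈ N := by
      intro μ hμ
      have hne : μ - ν ≠ 0 := sub_ne_zero.mpr fun h => hν (h ▸ hμ)
      obtain ⟨t, ht⟩ : ∃ t, (μ - ν) t ≠ 0 := by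
        by_contra! hcon
        exact hne (LinearMap.ext hcon)
      have h1 : ∑ μ ∈ s, (μ - ν) t • v μ ∈ N := by
        have h2 : ∑ μ ∈ s, (μ - ν) t • v μ =
            ⁅((t : zero Γ) : g), ∑ μ ∈ insert ν s, v μ⁆ - ν t • ∑ μ ∈ insert ν s, v μ := by
          rw [lie_sum, Finset.smul_sum, ← Finset.sum_sub_distrib, Finset.sum_insert hν,
            hv ν (Finset.mem_insert_self _ _) t, sub_self, zero_add]
          refine Finset.sum_congr rfl fun μ hμ => ?_
          rw [hv μ (Finset.mem_insert_of_mem hμ) t, ← sub_smul, LinearMap.sub_apply]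
        rw [h2]
        exact sub_mem (hN t _ hs) (N.smul_mem _ hs)
      have h3 := ih (fun μ => (μ - ν) t • v μ) (fun μ hμ t' => by
        rw [lie_smul, hv μ (Finset.mem_insert_of_mem hμ), smul_comm]) h1 μ hμ
      have h4 := N.smul_mem ((μ - ν) t)⁻¹ h3
      rwa [smul_smul, inv_mul_cancel₀ ht, one_smul] at h4
    intro μ hμ
    rcases Finset.mem_insert.mp hμ with rfl | hμ
    · rw [Finset.sum_insert hν] at hs
      have := sub_mem hs (sum_mem key)
      rwa [add_sub_cancel_right] at this
    · exact key μ hμ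

variable (Γ h) in
lemma lie_mem_weightSpace {μ ν : Dual ℂ h} {i j : ZMod n} {x y : g}
    (hx : x ∈ weightSpace Γ h μ i) (hy : y ∈ weightSpace Γ h ν j) :
    ⁅x, y⁆ ∈ weightSpace Γ h (μ + ν) (i + j) := by
  refine ⟨lie_mem_component hx.1 hy.1, fun t => ?_⟩
  rw [leibniz_lie, hx.2 t, hy.2 t, smul_lie, lie_smul, ← add_smul, LinearMap.add_apply]

lemma comp_mem_weightSpace [NeZero n] {μ : Dual ℂ h} {x : g}
    (hx : ∀ t : h, ⁅((t : zero Γ) : g), x⁆ = μ t • x) (j : ZMod n) :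
    comp Γ j x ∈ weightSpace Γ h μ j := by
  refine ⟨comp_mem Γ j x, fun t => ?_⟩
  have := comp_lie (mem_zero (t : zero Γ)) j x
  rw [sub_zero, hx t, map_smul] at this
  exact this.symm

variable (Γ h) in
lemma iSupIndep_weightSpace :
    iSupIndep fun p : Dual ℂ h × ZMod n => weightSpace Γ h p.1 p.2 := by
  classical
  rw [iSupIndep_iff_finsetSum_eq_zero_imp_eq_zero]
  intro s v hv hs p hp
  have h1 : ∑ q ∈ s with q.2 = p.2, v q = 0 := by
    have := congrArg (comp Γ p.2) hs
    rw [map_sum, map_zero] at this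
    rw [← this, Finset.sum_filter]
    refine Finset.sum_congr rfl fun q hq => ?_
    split_ifs with h
    · exact (comp_of_mem Γ (h ▸ (hv q hq).1)).symm
    · exact (comp_of_mem_ne Γ (hv q hq).1 h).symm
  have h2 : ∑ μ ∈ (s.filter fun q => q.2 = p.2).image Prod.fst, v (μ, p.2) = 0 := by
    rw [Finset.sum_image, ← h1]
    · refine Finset.sum_congr rfl fun q hq => ?_
      rw [← (Finset.mem_filter.mp hq).2]
    · intro q hq q' hq' hqq
      rw [Finset.mem_coe, Finset.mem_filter] at hq hq'
      exact Prod.ext hqq (hq.2.trans hq'.2.symm)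
  have h3 := mem_of_sum_mem (N := ⊥) (h := h) (Γ := Γ)
    (fun t x hx => by rw [Submodule.mem_bot] at hx; rw [hx, lie_zero]; exact zero_mem _)
    ((s.filter fun q => q.2 = p.2).image Prod.fst) (fun μ => v (μ, p.2)) (fun μ hμ t => by
      obtain ⟨q, hq, rfl⟩ := Finset.mem_image.mp hμ
      have hq' := Finset.mem_filter.mp hq
      have := (hv q hq'.1).2 t
      rw [← hq'.2]
      exact this) (by rw [h2]; exact zero_mem _) p.1
    (Finset.mem_image.mpr ⟨p, Finset.mem_filter.mpr ⟨hp, rfl⟩, rfl⟩)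
  exact (Submodule.mem_bot ℂ).mp h3

variable [FiniteDimensional ℂ g]

variable (Γ h) in
lemma finite_weights :
    {p : Dual ℂ h × ZMod n | weightSpace Γ h p.1 p.2 ≠ ⊥}.Finite :=
  WellFoundedGT.finite_ne_bot_of_iSupIndep (iSupIndep_weightSpace Γ h)

/-- Orthogonality of graded weight spaces of non-opposite weights. -/
lemma killingForm_weightSpace {μ ν : Dual ℂ h} {i j : ZMod n} {x y : g}
    (hx : x ∈ weightSpace Γ h μ i) (hy : y ∈ weightSpace Γ h ν j)
    (hne : ¬ (μ + ν = 0 ∧ i + j = 0)) : killingForm ℂ g x y = 0 := by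
  by_cases hij : i + j = 0
  · have hμν : μ + ν ≠ 0 := fun h => hne ⟨h, hij⟩
    obtain ⟨t, ht⟩ : ∃ t, (μ + ν) t ≠ 0 := by
      by_contra! hcon
      exact hμν (LinearMap.ext hcon)
    have h1 := killingForm_lie x ((t : zero Γ) : g) y
    rw [← lie_skew, hx.2 t, hy.2 t, map_neg, map_smul, map_smul, LinearMap.neg_apply,
      LinearMap.smul_apply, smul_eq_mul, smul_eq_mul] at h1
    have h2 : (μ + ν) t * killingForm ℂ g x y = 0 := by
      rw [LinearMap.add_apply]; linear_combination -h1
    exact (mul_eq_zero.mp h2).resolve_left ht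
  · exact killingForm_of_add_ne_zero hx.1 hy.1 hij

variable [NeZero n] [LieAlgebra.IsKilling ℂ g]

lemma eq_zero_of_isNilpotent_cartan (hh : h.IsCartanSubalgebra) (s : h)
    (hs : IsNilpotent (LieAlgebra.ad ℂ g ((s : zero Γ) : g))) : s = 0 := by
  refine eq_zero_of_forall_cartan hh s fun t => ?_
  have hcomm : Commute (LieAlgebra.ad ℂ g ((s : zero Γ) : g))
      (LieAlgebra.ad ℂ g ((t : zero Γ) : g)) :=
    commute_ad (lie_cartan hh s t)
  rw [killingForm_apply_apply]
  exact (LinearMap.isNilpotent_trace_of_isNilpotent (hcomm.isNilpotent_mul_right hs)).eq_zero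

/-- The elements of the Cartan subalgebra of `g_0` are semisimple in `g`: the semisimple part of
such an element is of degree zero and centralizes the Cartan subalgebra, hence lies in it, and an
`ad`-nilpotent element of the Cartan subalgebra is zero. -/
lemma lie_eq_smul_of_mem_maxGenEigenspace (hh : h.IsCartanSubalgebra) (t : h) {a : ℂ} {y : g}
    (hy : y ∈ (LieAlgebra.ad ℂ g ((t : zero Γ) : g)).maxGenEigenspace a) :
    ⁅((t : zero Γ) : g), y⁆ = a • y := by
  set T := LieAlgebra.ad ℂ g ((t : zero Γ) : g) with hT
  obtain ⟨s, -, hnil, heig⟩ := exists_semisimple_part ((t : zero Γ) : g)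
  have hcompT : ∀ (i : ZMod n), Commute T (comp Γ i) := by
    intro i
    ext x
    have := comp_lie (mem_zero (t : zero Γ)) i x
    rw [sub_zero] at this
    exact this.symm
  -- `ad s` commutes with the projections onto the graded components.
  have hscomp : ∀ (i : ZMod n) (x : g), ⁅s, comp Γ i x⁆ = comp Γ i ⁅s, x⁆ := by
    intro i x
    have hx : x ∈ ⨆ a : ℂ, T.maxGenEigenspace a := by
      rw [Module.End.iSup_maxGenEigenspace_eq_top]; trivial
    induction hx using Submodule.iSup_induction' with
    | mem a x hx =>
      rw [heig a x hx, map_smul]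
      exact heig a _ (T.mapsTo_maxGenEigenspace_of_comm (hcompT i) a hx)
    | zero => simp
    | add _ _ _ _ h h' => simp only [lie_add, map_add, h, h']
  have hs0 : s = comp Γ 0 s := by
    rw [← sub_eq_zero]
    refine eq_zero_of_lie fun x => ?_
    rw [← sum_comp Γ x, lie_sum]
    refine Finset.sum_eq_zero fun i _ => ?_
    have h1 := hscomp i (comp Γ i x)
    rw [comp_of_mem Γ (comp_mem Γ i x), ← lie_skew, map_neg, comp_lie (comp_mem Γ i x), sub_self]
      at h1
    rw [lie_skew, lie_skew] at h1
    rw [sub_lie, h1, sub_self]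
  have hsΓ : s ∈ Γ 0 := by rw [hs0]; exact comp_mem Γ 0 s
  obtain ⟨s', hs'⟩ := mem_cartan hh hsΓ fun t' => by
    have : ((t' : zero Γ) : g) ∈ T.maxGenEigenspace 0 := by
      rw [Module.End.mem_maxGenEigenspace]
      exact ⟨1, by simpa [hT] using lie_cartan hh t t'⟩
    rw [← lie_skew, heig 0 _ this, zero_smul, neg_zero]
  have hts : t - s' = 0 := by
    refine eq_zero_of_isNilpotent_cartan hh _ ?_
    rw [← hs', ← map_sub] at hnil
    exact hnil
  rw [sub_eq_zero.mp hts, hs']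
  exact heig a y hy

/-- Under the Cartan subalgebra of `g_0`, the Lie algebra `g` is the sum of its graded weight
spaces. -/
lemma mem_iSup_weightSpace (hh : h.IsCartanSubalgebra) {j : ZMod n} {x : g} (hx : x ∈ Γ j) :
    x ∈ ⨆ μ : Dual ℂ h, weightSpace Γ h μ j := by
  have htop : ⨆ χ : h → ℂ, ⨅ t : h,
      (LieAlgebra.ad ℂ g ((t : zero Γ) : g)).maxGenEigenspace (χ t) = ⊤ := by
    refine Module.End.iSup_iInf_maxGenEigenspace_eq_top_of_forall_mapsTo _ (fun s t a => ?_)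
      fun t => Module.End.iSup_maxGenEigenspace_eq_top _
    exact Module.End.mapsTo_maxGenEigenspace_of_comm (commute_ad (lie_cartan hh t s)) a
  have key : ∀ y : g, comp Γ j y ∈ ⨆ μ : Dual ℂ h, weightSpace Γ h μ j := by
    intro y
    have hy : y ∈ ⨆ χ : h → ℂ, ⨅ t : h,
      (LieAlgebra.ad ℂ g ((t : zero Γ) : g)).maxGenEigenspace (χ t) := by rw [htop]; trivial
    induction hy using Submodule.iSup_induction' with
    | mem χ y hy =>
      rw [Submodule.mem_iInf] at hy
      have hy' : ∀ t : h, ⁅((t : zero Γ) : g), y⁆ = χ t • y := fun t =>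
        lie_eq_smul_of_mem_maxGenEigenspace hh t (hy t)
      by_cases hy0 : y = 0
      · rw [hy0, map_zero]; exact zero_mem _
      -- A weight with a non-zero weight vector is linear.
      let μ : Dual ℂ h :=
        { toFun := χ
          map_add' := fun s t => by
            refine smul_left_injective ℂ hy0 ?_
            change χ (s + t) • y = (χ s + χ t) • y
            rw [← hy', add_smul, ← hy', ← hy', ← add_lie]
            rfl
          map_smul' := fun c t => by
            refine smul_left_injective ℂ hy0 ?_
            change χ (c • t) • y = (c * χ t) • y
            rw [← hy', mul_smul, ← hy', ← smul_lie]
            rfl }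
      exact Submodule.mem_iSup_of_mem μ (comp_mem_weightSpace (μ := μ) hy' j)
    | zero => rw [map_zero]; exact zero_mem _
    | add _ _ _ _ h h' => rw [map_add]; exact add_mem h h'
  have := key x
  rwa [comp_of_mem Γ hx] at this

lemma iSup_weightSpace (hh : h.IsCartanSubalgebra) :
    ⨆ p : Dual ℂ h × ZMod n, weightSpace Γ h p.1 p.2 = ⊤ := by
  rw [eq_top_iff]
  intro x _
  rw [← sum_comp Γ x]
  refine sum_mem fun j _ => ?_
  have h1 : (⨆ μ : Dual ℂ h, weightSpace Γ h μ j) ≤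
      ⨆ p : Dual ℂ h × ZMod n, weightSpace Γ h p.1 p.2 :=
    iSup_le fun μ => le_iSup (fun p : Dual ℂ h × ZMod n => weightSpace Γ h p.1 p.2) (μ, j)
  exact h1 (mem_iSup_weightSpace hh (comp_mem Γ j x))

lemma isInternal_weightSpace [DecidableEq (Dual ℂ h × ZMod n)] (hh : h.IsCartanSubalgebra) :
    DirectSum.IsInternal fun p : Dual ℂ h × ZMod n => weightSpace Γ h p.1 p.2 :=
  DirectSum.isInternal_submodule_of_iSupIndep_of_iSup_eq_top (iSupIndep_weightSpace Γ h)
    (iSup_weightSpace hh)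

lemma exists_killingForm_ne_zero (hh : h.IsCartanSubalgebra) {μ : Dual ℂ h} {j : ZMod n} {x : g}
    (hx : x ∈ weightSpace Γ h μ j) (hx0 : x ≠ 0) :
    ∃ y ∈ weightSpace Γ h (-μ) (-j), killingForm ℂ g x y ≠ 0 := by
  by_contra! hcon
  refine hx0 (eq_zero_of_killingForm fun y => ?_)
  have hy : y ∈ ⨆ p : Dual ℂ h × ZMod n, weightSpace Γ h p.1 p.2 := by
    rw [iSup_weightSpace hh]; trivial
  induction hy using Submodule.iSup_induction' with
  | mem p y hy =>
    by_cases hp : μ + p.1 = 0 ∧ j + p.2 = 0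
    · refine hcon y ?_
      rwa [neg_eq_of_add_eq_zero_right hp.1, neg_eq_of_add_eq_zero_right hp.2]
    · exact killingForm_weightSpace hx hy hp
  | zero => simp
  | add _ _ _ _ h h' => rw [map_add, h, h', add_zero]

end Weights

/-! ### Root gradings -/

section RootGrading

variable {g V D : Type*} [LieRing g] [LieAlgebra ℂ g] [AddCommGroup V] [AddCommGroup D]

/-- `e` and `f` are root vectors of weights `c` and `-c`, and `[e, f]` acts on the space of weight
`q` by the inner product of `c` and `q`. -/
structure IsTriple (G : V × D → Submodule ℂ g) (ip : V →+ V →+ ℝ) (c : V × D) (e f : g) : Prop where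
  mem : e ∈ G c
  mem_neg : f ∈ G (-c)
  scalar : ∀ q, ∀ x ∈ G q, ⁅⁅e, f⁆, x⁆ = (ip c.1 q.1 : ℂ) • x

/-- The properties of the graded weight spaces `G (μ, j)` used below. They are those of a loop
algebra: the weights `(μ, j)` with `μ ≠ 0` behave like real roots, that is, they have positive
length, belong to `sl₂`-triples and have multiplicity one, whereas nothing is asked of the
weights `(0, j)`. -/
structure IsRootGrading (G : V × D → Submodule ℂ g) (ip : V →+ V →+ ℝ) : Prop where
  lie_mem : ∀ p q, ∀ x ∈ G p, ∀ y ∈ G q, ⁅x, y⁆ ∈ G (p + q)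
  finite : {p | G p ≠ ⊥}.Finite
  pos : ∀ p, G p ≠ ⊥ → p.1 ≠ 0 → 0 < ip p.1 p.1
  triple : ∀ p, G p ≠ ⊥ → p.1 ≠ 0 → ∃ e f, IsTriple G ip p e f
  line : ∀ p, G p ≠ ⊥ → p.1 ≠ 0 → ∀ x ∈ G p, x ≠ 0 → ∀ y ∈ G p, ∃ a : ℂ, y = a • x

variable {G : V × D → Submodule ℂ g} {ip : V →+ V →+ ℝ} {c p : V × D} {e f : g}

namespace IsRootGrading

lemma neg_ne_bot (hG : IsRootGrading G ip) (hc : G c ≠ ⊥) (hc0 : c.1 ≠ 0) : G (-c) ≠ ⊥ := by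
  obtain ⟨e, f, ht⟩ := hG.triple c hc hc0
  obtain ⟨x, hx, hx0⟩ := Submodule.exists_mem_ne_zero_of_ne_bot hc
  intro hbot
  have hf : f = 0 := by
    have := ht.mem_neg
    rwa [hbot, Submodule.mem_bot] at this
  have h1 := ht.scalar c x hx
  rw [hf, lie_zero, zero_lie] at h1
  rcases smul_eq_zero.mp h1.symm with h2 | h2
  · exact (hG.pos c hc hc0).ne' (by exact_mod_cast h2)
  · exact hx0 h2

lemma isString (hG : IsRootGrading G ip) (ht : IsTriple G ip c e f) (p : V × D) :
    IsString e f (fun m : ℤ => G (p + m • c))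
      (fun m : ℤ => ((ip c.1 p.1 + m * ip c.1 c.1 : ℝ) : ℂ)) where
  raise m x hx := by
    have := hG.lie_mem _ _ _ ht.mem _ hx
    rwa [show c + (p + m • c) = p + (m + 1) • c by rw [add_smul, one_smul]; abel] at this
  lower m x hx := by
    have := hG.lie_mem _ _ _ ht.mem_neg _ hx
    rwa [show -c + (p + (m + 1) • c) = p + m • c by rw [add_smul, one_smul]; abel] at this
  scalar m x hx := by
    rw [ht.scalar _ x hx]
    simp

lemma exists_bounds (hG : IsRootGrading G ip) (hc : G c ≠ ⊥) (hc0 : c.1 ≠ 0) (p : V × D) :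
    ∃ a b : ℤ, (∀ m ≤ a, G (p + m • c) = ⊥) ∧ ∀ m ≥ b, G (p + m • c) = ⊥ := by
  have hinj : Function.Injective fun m : ℤ => p + m • c := by
    intro m m' hmm
    have h1 : m • c = m' • c := add_left_cancel hmm
    have h2 := congrArg (fun q : V × D => ip c.1 q.1) h1
    simp only [Prod.smul_fst, map_zsmul, zsmul_eq_mul] at h2
    exact_mod_cast mul_right_cancel₀ (hG.pos c hc hc0).ne' h2
  have hfin : {m : ℤ | G (p + m • c) ≠ ⊥}.Finite := hG.finite.preimage hinj.injOn
  obtain ⟨a, ha⟩ := hfin.bddBelow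
  obtain ⟨b, hb⟩ := hfin.bddAbove
  refine ⟨a - 1, b + 1, fun m hm => ?_, fun m hm => ?_⟩
  · by_contra h
    have := ha h
    omega
  · by_contra h
    have := hb h
    omega

/-- A subspace which meets a one-dimensional weight space non-trivially contains it. -/
lemma le_of_mem (hG : IsRootGrading G ip) (hc0 : c.1 ≠ 0) {x : g} (hx : x ∈ G c) (hx0 : x ≠ 0)
    {N : Submodule ℂ g} (hN : x ∈ N) : G c ≤ N := by
  intro y hy
  obtain ⟨a, rfl⟩ := hG.line c ((Submodule.ne_bot_iff _).mpr ⟨x, hx, hx0⟩) hc0 x hx hx0 y hy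
  exact N.smul_mem a hN

variable [FiniteDimensional ℂ g]

/-- If the inner product of a real weight `c` with a weight `p` is negative, then the space of
weight `p` is not killed by the root vector of weight `c`. -/
lemma exists_lie_ne_zero_of_neg (hG : IsRootGrading G ip) (hc : G c ≠ ⊥) (hc0 : c.1 ≠ 0)
    (ht : IsTriple G ip c e f) (hp : G p ≠ ⊥) (hneg : ip c.1 p.1 < 0) :
    ∃ x ∈ G p, ⁅e, x⁆ ≠ 0 := by
  by_contra! hcon
  obtain ⟨a, b, ha, hb⟩ := hG.exists_bounds hc hc0 p
  have hpos := hG.pos c hc hc0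
  refine (hG.isString ht p).false_of_neg ha (b := 0) (m := 0) (by simpa using hcon)
    (fun m hm _ => ?_) le_rfl (by simpa using hp) (by simpa using hneg)
  have : (m : ℝ) * ip c.1 c.1 ≤ 0 :=
    mul_nonpos_of_nonpos_of_nonneg (by exact_mod_cast hm) hpos.le
  rw [Complex.ofReal_re]
  linarith

lemma add_ne_bot_of_neg (hG : IsRootGrading G ip) (hc : G c ≠ ⊥) (hc0 : c.1 ≠ 0) (hp : G p ≠ ⊥)
    (hneg : ip c.1 p.1 < 0) : G (c + p) ≠ ⊥ := by
  obtain ⟨e, f, ht⟩ := hG.triple c hc hc0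
  obtain ⟨x, hx, hx0⟩ := hG.exists_lie_ne_zero_of_neg hc hc0 ht hp hneg
  exact Submodule.ne_bot_iff _ |>.mpr ⟨_, hG.lie_mem _ _ _ ht.mem _ hx, hx0⟩

lemma sub_ne_bot_of_pos (hG : IsRootGrading G ip) (hc : G c ≠ ⊥) (hc0 : c.1 ≠ 0) (hp : G p ≠ ⊥)
    (hpos : 0 < ip c.1 p.1) : G (p - c) ≠ ⊥ := by
  rw [sub_eq_neg_add]
  refine hG.add_ne_bot_of_neg (hG.neg_ne_bot hc hc0) (by simpa using hc0) hp ?_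
  simpa using hpos

/-- If `c` is a real weight, and `p` and `c + p` are weights, then the space of weight `p` is not
killed by the root vector of weight `c`. Otherwise, the string through `p` would split into two
parts, on each of which the trace of the coroot of `c` vanishes; but the eigenvalues of the coroot
are larger on the upper part. -/
lemma exists_lie_ne_zero (hG : IsRootGrading G ip) (hc : G c ≠ ⊥) (hc0 : c.1 ≠ 0)
    (ht : IsTriple G ip c e f) (hp : G p ≠ ⊥) (hcp : G (c + p) ≠ ⊥) :
    ∃ x ∈ G p, ⁅e, x⁆ ≠ 0 := by
  rcases lt_or_ge (ip c.1 p.1) 0 with hneg | hnn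
  · exact hG.exists_lie_ne_zero_of_neg hc hc0 ht hp hneg
  by_contra! hcon
  obtain ⟨a, b, ha, hb⟩ := hG.exists_bounds hc hc0 p
  have hpos := hG.pos c hc hc0
  refine (hG.isString ht p).false_of_pos (a := 0) (m := 1) (by simpa using hcon) hb
    (fun m hm _ => ?_) one_pos (by simpa [add_comm] using hcp)
  have : 0 < (m : ℝ) * ip c.1 c.1 := mul_pos (by exact_mod_cast hm) hpos
  rw [Complex.ofReal_re]
  linarith

/-- If `c` and `p` are weights with opposite non-zero parts in `V`, then `(ad e)^2` does not kill
the space of weight `p`, where `e` is the root vector of weight `c`. -/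
lemma exists_lie_lie_ne_zero (hG : IsRootGrading G ip) (hc : G c ≠ ⊥) (hc0 : c.1 ≠ 0)
    (ht : IsTriple G ip c e f) (hp : G p ≠ ⊥) (hcp : p.1 = -c.1) :
    ∃ x ∈ G p, ⁅e, ⁅e, x⁆⁆ ≠ 0 := by
  by_contra! hcon
  obtain ⟨a, b, ha, hb⟩ := hG.exists_bounds hc hc0 p
  have hpos := hG.pos c hc hc0
  have hS := hG.isString ht p
  set N : ℤ → Submodule ℂ g := fun m =>
    if m ≤ 0 then G (p + m • c) else if m = 1 then (G p).map (LieAlgebra.ad ℂ g e) else ⊥ with hN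
  have hN0 : ∀ m ≤ 0, N m = G (p + m • c) := fun m hm => by simp [hN, hm]
  have hN1 : N 1 = (G p).map (LieAlgebra.ad ℂ g e) := by simp [hN]
  have hN2 : ∀ m ≥ 2, N m = ⊥ := fun m hm => by
    simp [hN, show ¬ m ≤ 0 by omega, show m ≠ 1 by omega]
  have hp0 : N 0 = G p := by rw [hN0 0 le_rfl, zero_smul, add_zero]
  have hle : ∀ m, N m ≤ G (p + m • c) := by
    intro m
    rcases le_or_gt m 0 with hm | hm
    · rw [hN0 m hm]
    rcases (by omega : m = 1 ∨ 2 ≤ m) with rfl | hm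
    · rw [hN1]
      rintro _ ⟨x, hx, rfl⟩
      have := hS.raise 0 x (by simpa using hx)
      simpa using this
    · rw [hN2 m hm]; exact bot_le
  have hS' : IsString e f N (fun m : ℤ => ((ip c.1 p.1 + m * ip c.1 c.1 : ℝ) : ℂ)) := by
    refine ⟨fun m x hx => ?_, fun m x hx => ?_, fun m x hx => hS.scalar m x (hle m hx)⟩
    · rcases (by omega : m + 1 ≤ 0 ∨ m = 0 ∨ m = 1 ∨ 2 ≤ m) with hm | rfl | rfl | hm
      · rw [hN0 _ hm]
        exact hS.raise m x (hle m hx)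
      · rw [hp0] at hx
        rw [zero_add, hN1]
        exact ⟨x, hx, rfl⟩
      · rw [hN1] at hx
        obtain ⟨y, hy, rfl⟩ := hx
        rw [LieAlgebra.ad_apply, hcon y hy]
        exact zero_mem _
      · rw [hN2 m hm, Submodule.mem_bot] at hx
        rw [hx, lie_zero]
        exact zero_mem _
    · rcases le_or_gt m 0 with hm | hm
      · rw [hN0 m hm]
        exact hS.lower m x (hle _ hx)
      · rw [hN2 _ (by omega), Submodule.mem_bot] at hx
        rw [hx, lie_zero]
        exact zero_mem _
  have hip : ip c.1 p.1 = -ip c.1 c.1 := by rw [hcp, map_neg]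
  refine hS'.false_of_neg (a := min a 0) (b := 1) (m := 0) (fun m hm => ?_) (fun x hx => ?_)
    (fun m hm _ => ?_) zero_le_one (hp0 ▸ hp) ?_
  · rw [hN0 m (hm.trans (min_le_right _ _))]
    exact ha m (hm.trans (min_le_left _ _))
  · rw [hN1] at hx
    obtain ⟨y, hy, rfl⟩ := hx
    exact hcon y hy
  · rw [Complex.ofReal_re, hip]
    have : (m : ℝ) * ip c.1 c.1 ≤ 1 * ip c.1 c.1 :=
      mul_le_mul_of_nonneg_right (by exact_mod_cast hm) hpos.le
    linarith
  · rw [Complex.ofReal_re, hip]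
    simpa using hpos

lemma reflect_ne_bot (hG : IsRootGrading G ip) (hc : G c ≠ ⊥) (hc0 : c.1 ≠ 0) (hp : G p ≠ ⊥)
    (hcp : p.1 = -c.1) : G (c + (c + p)) ≠ ⊥ := by
  obtain ⟨e, f, ht⟩ := hG.triple c hc hc0
  obtain ⟨x, hx, hx0⟩ := hG.exists_lie_lie_ne_zero hc hc0 ht hp hcp
  exact Submodule.ne_bot_iff _ |>.mpr
    ⟨_, hG.lie_mem _ _ _ ht.mem _ (hG.lie_mem _ _ _ ht.mem _ hx), hx0⟩

/-- If `c` and `p` are weights with opposite non-zero parts in `V`, then all the `c + s (c + p)` and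
all the `(s + 1) (c + p)` are weights. The composite of the reflections in `c` and `p` is the
translation by `2 (c + p)`. -/
lemma nsmul_ne_bot (hG : IsRootGrading G ip) (hc : G c ≠ ⊥) (hc0 : c.1 ≠ 0) (hp : G p ≠ ⊥)
    (hcp : p.1 = -c.1) (s : ℕ) :
    G (c + s • (c + p)) ≠ ⊥ ∧ G ((s + 1) • (c + p)) ≠ ⊥ := by
  have hp0 : p.1 ≠ 0 := by rw [hcp]; exact neg_ne_zero.mpr hc0
  have hfst : ∀ s : ℕ, (c + s • (c + p)).1 = c.1 := fun s => by simp [hcp]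
  have key : ∀ s : ℕ, G (c + s • (c + p)) ≠ ⊥ ∧ G (c + (s + 1) • (c + p)) ≠ ⊥ := by
    intro s
    induction s with
    | zero =>
      refine ⟨by simpa using hc, ?_⟩
      simpa using hG.reflect_ne_bot hc hc0 hp hcp
    | succ s ih =>
      refine ⟨ih.2, ?_⟩
      have h1 := hG.reflect_ne_bot hp hp0 ih.1 (by rw [hfst, hcp, neg_neg])
      have h2 := hG.reflect_ne_bot hc hc0 h1 (by
        rw [Prod.fst_add, Prod.fst_add, hfst, hcp]; abel)
      rwa [show c + (c + (p + (p + (c + s • (c + p))))) = c + (s + 1 + 1) • (c + p) by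
        rw [add_smul, add_smul, one_smul]; abel] at h2
  refine ⟨(key s).1, ?_⟩
  have h1 := hG.add_ne_bot_of_neg hp hp0 (key s).1 (by
    rw [hfst, show c.1 = -p.1 by rw [hcp, neg_neg], map_neg]
    exact neg_lt_zero.mpr (hG.pos p hp hp0))
  rwa [show p + (c + s • (c + p)) = (s + 1) • (c + p) by rw [add_smul, one_smul]; abel] at h1

/-- The main combinatorial fact. Let `F` be a filtration compatible with the bracket, such that no
two real root spaces contained in the filtration have opposite weights. Consider a non-empty family
of real root spaces `G c ≤ F l`. Then the sum of the weights `c` is not imaginary and, if it is a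
weight, its root space is contained in `F` of the sum of the levels `l`.

Two members of the family with negative inner product may be replaced by their sum. If there are no
such members, each member has positive inner product with the total sum, so that it may be removed,
and added again at the end. -/
theorem sum_mem_filtration (hG : IsRootGrading G ip) {F : ℕ → Submodule ℂ g}
    (hF : ∀ l m, ∀ x ∈ F l, ∀ y ∈ F m, ⁅x, y⁆ ∈ F (l + m))
    (hopp : ∀ (c c' : V × D) (l l' : ℕ), G c ≠ ⊥ → c.1 ≠ 0 → G c ≤ F l → G c' ≠ ⊥ → c'.1 ≠ 0 →
      G c' ≤ F l' → c.1 + c'.1 ≠ 0)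
    (s : Multiset ((V × D) × ℕ)) (hs0 : s ≠ 0)
    (hs : ∀ a ∈ s, G a.1 ≠ ⊥ ∧ a.1.1 ≠ 0 ∧ G a.1 ≤ F a.2) :
    s.sum.1.1 ≠ 0 ∧ G s.sum.1 ≤ F s.sum.2 := by
  classical
  induction hk : s.card using Nat.strong_induction_on generalizing s with
  | _ k ih =>
  subst hk
  by_cases hneg : ∃ a u, s = a ::ₘ u ∧ ∃ a' ∈ u, ip a.1.1 a'.1.1 < 0
  · obtain ⟨a, u, rfl, a', ha', hlt⟩ := hneg
    obtain ⟨w, rfl⟩ := Multiset.exists_cons_of_mem ha'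
    obtain ⟨h1, h2, h3⟩ := hs a (by simp)
    obtain ⟨h1', h2', h3'⟩ := hs a' (by simp)
    obtain ⟨e, f, ht⟩ := hG.triple a.1 h1 h2
    obtain ⟨x, hx, hx0⟩ := hG.exists_lie_ne_zero_of_neg h1 h2 ht h1' hlt
    have hmem := hG.lie_mem _ _ _ ht.mem _ hx
    have hne : (a.1 + a'.1).1 ≠ 0 := hopp _ _ _ _ h1 h2 h3 h1' h2' h3'
    have := ih ((a + a') ::ₘ w).card (by simp) ((a + a') ::ₘ w) (by simp) (fun b hb => by
      rcases Multiset.mem_cons.mp hb with rfl | hb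
      · exact ⟨(Submodule.ne_bot_iff _).mpr ⟨_, hmem, hx0⟩, hne,
          hG.le_of_mem hne hmem hx0 (hF _ _ _ (h3 ht.mem) _ (h3' hx))⟩
      · exact hs b (by simp [hb])) rfl
    rwa [Multiset.sum_cons, add_assoc, ← Multiset.sum_cons, ← Multiset.sum_cons] at this
  · obtain ⟨a, ha⟩ := Multiset.exists_mem_of_ne_zero hs0
    obtain ⟨u, rfl⟩ := Multiset.exists_cons_of_mem ha
    obtain ⟨h1, h2, h3⟩ := hs a (by simp)
    by_cases hu : u = 0
    · subst hu
      simpa using ⟨h2, h3⟩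
    have hnn : ∀ a' ∈ u, 0 ≤ ip a.1.1 a'.1.1 := fun a' ha' => by
      by_contra hcon
      exact hneg ⟨a, u, rfl, a', ha', not_le.mp hcon⟩
    have hsum : 0 ≤ ip a.1.1 u.sum.1.1 := by
      have hhom : ip a.1.1 u.sum.1.1 = (u.map fun a' => ip a.1.1 a'.1.1).sum :=
        map_multiset_sum ((ip a.1.1).comp
          ((AddMonoidHom.fst V D).comp (AddMonoidHom.fst (V × D) ℕ))) u
      rw [hhom]
      refine Multiset.sum_nonneg fun r hr => ?_
      obtain ⟨a', ha', rfl⟩ := Multiset.mem_map.mp hr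
      exact hnn a' ha'
    have hpos : 0 < ip a.1.1 (a ::ₘ u).sum.1.1 := by
      rw [Multiset.sum_cons, Prod.fst_add, Prod.fst_add, map_add]
      linarith [hG.pos a.1 h1 h2]
    have hne : (a ::ₘ u).sum.1.1 ≠ 0 := by
      intro h
      rw [h, map_zero] at hpos
      exact lt_irrefl _ hpos
    refine ⟨hne, ?_⟩
    by_cases hbot : G (a ::ₘ u).sum.1 = ⊥
    · rw [hbot]; exact bot_le
    have hbot' : G u.sum.1 ≠ ⊥ := by
      have := hG.sub_ne_bot_of_pos h1 h2 hbot hpos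
      rwa [Multiset.sum_cons, Prod.fst_add, add_sub_cancel_left] at this
    obtain ⟨-, hle⟩ := ih u.card (by simp) u hu (fun b hb => hs b (by simp [hb])) rfl
    obtain ⟨e, f, ht⟩ := hG.triple a.1 h1 h2
    rw [Multiset.sum_cons] at hne hbot ⊢
    obtain ⟨x, hx, hx0⟩ := hG.exists_lie_ne_zero h1 h2 ht hbot' hbot
    exact hG.le_of_mem hne (hG.lie_mem _ _ _ ht.mem _ hx) hx0 (hF _ _ _ (h3 ht.mem) _ (hle hx))

/-- A filtration whose levels vanish eventually does not contain root spaces with opposite weights,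
one of which is of positive level: reflecting one of them in the other repeatedly would give root
spaces of arbitrarily high level. -/
lemma add_ne_zero_of_nilpotent (hG : IsRootGrading G ip) {F : ℕ → Submodule ℂ g}
    (hF : ∀ l m, ∀ x ∈ F l, ∀ y ∈ F m, ⁅x, y⁆ ∈ F (l + m)) {k : ℕ} (hk : ∀ l ≥ k, F l = ⊥)
    {c p : V × D} {l l' : ℕ} (hc : G c ≠ ⊥) (hc0 : c.1 ≠ 0) (hcl : G c ≤ F l) (hl : l ≠ 0)
    (hp : G p ≠ ⊥) (hpl : G p ≤ F l') : c.1 + p.1 ≠ 0 := by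
  intro hcp
  have key : ∀ N : ℕ, ∃ (d : V × D) (r : ℕ), N < r ∧ G d ≠ ⊥ ∧ d.1 = c.1 ∧ G d ≤ F r := by
    intro N
    induction N with
    | zero => exact ⟨c, l, Nat.pos_of_ne_zero hl, hc, rfl, hcl⟩
    | succ N ih =>
      obtain ⟨d, r, hr, hd, hdc, hdr⟩ := ih
      have hpd : p.1 = -d.1 := by rw [hdc]; exact (neg_eq_of_add_eq_zero_right hcp).symm
      have hd0 : d.1 ≠ 0 := hdc ▸ hc0
      obtain ⟨e, f, ht⟩ := hG.triple d hd hd0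
      obtain ⟨x, hx, hx0⟩ := hG.exists_lie_lie_ne_zero hd hd0 ht hp hpd
      have hmem := hG.lie_mem _ _ _ ht.mem _ (hG.lie_mem _ _ _ ht.mem _ hx)
      have hfst : (d + (d + p)).1 = c.1 := by
        rw [Prod.fst_add, Prod.fst_add, hpd, hdc]; abel
      refine ⟨d + (d + p), r + (r + l'), by omega, (Submodule.ne_bot_iff _).mpr ⟨_, hmem, hx0⟩,
        hfst, hG.le_of_mem (hfst ▸ hc0) hmem hx0 ?_⟩
      exact hF _ _ _ (hdr ht.mem) _ (hF _ _ _ (hdr ht.mem) _ (hpl hx))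
  obtain ⟨d, r, hr, hd, -, hdr⟩ := key k
  rw [hk r hr.le] at hdr
  exact hd (le_bot_iff.mp hdr)

end IsRootGrading

end RootGrading

/-! ### The graded weight spaces form a root grading -/

section Instance

variable {n : ℕ} {g : Type*} [LieRing g] [LieAlgebra ℂ g]
  {Γ : ZMod n → Submodule ℂ g} [GradedLieAlgebra Γ] {h : LieSubalgebra ℂ (zero Γ)}

variable (Γ h) in
/-- The graded weight spaces, as a family indexed by pairs. -/
abbrev gr (p : Dual ℂ h × ZMod n) : Submodule ℂ g := weightSpace Γ h p.1 p.2

lemma zsmul_injective {μ : Dual ℂ h} (hμ : μ ≠ 0) (p : Dual ℂ h × ZMod n) (j : ZMod n) :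
    Function.Injective fun m : ℤ => p + m • (μ, j) := by
  intro m m' hmm
  have h1 : m • (μ, j) = m' • (μ, j) := add_left_cancel hmm
  have h2 : m • μ = m' • μ := congrArg Prod.fst h1
  have h3 : ((m : ℂ) - m') • μ = 0 := by
    rw [sub_smul, Int.cast_smul_eq_zsmul, Int.cast_smul_eq_zsmul, h2, sub_self]
  have h4 := (smul_eq_zero.mp h3).resolve_right hμ
  exact_mod_cast sub_eq_zero.mp h4

variable [FiniteDimensional ℂ g]

lemma exists_weight_bounds {μ : Dual ℂ h} (hμ : μ ≠ 0) (p : Dual ℂ h × ZMod n) (j : ZMod n) :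
    ∃ a b : ℤ, (∀ m ≤ a, gr Γ h (p + m • (μ, j)) = ⊥) ∧
      ∀ m ≥ b, gr Γ h (p + m • (μ, j)) = ⊥ := by
  have hfin : {m : ℤ | gr Γ h (p + m • (μ, j)) ≠ ⊥}.Finite :=
    (finite_weights Γ h).preimage (zsmul_injective hμ p j).injOn
  obtain ⟨a, ha⟩ := hfin.bddBelow
  obtain ⟨b, hb⟩ := hfin.bddAbove
  refine ⟨a - 1, b + 1, fun m hm => ?_, fun m hm => ?_⟩
  · by_contra h
    have := ha h
    omega
  · by_contra h
    have := hb h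
    omega

variable [NeZero n] [LieAlgebra.IsKilling ℂ g]

lemma traceForm_nondegenerate (hh : h.IsCartanSubalgebra) :
    (LieModule.traceForm ℂ h g).Nondegenerate := by
  refine (LieModule.traceForm_isSymm ℂ h g).isRefl.nondegenerate_iff_separatingLeft.mpr ?_
  exact fun s hs => eq_zero_of_forall_cartan hh s hs

/-- The element of the Cartan subalgebra representing `μ` with respect to the Killing form
of `g`. -/
noncomputable def repr (hh : h.IsCartanSubalgebra) : Dual ℂ h ≃ₗ[ℂ] h :=
  ((LieModule.traceForm ℂ h g).toDual (traceForm_nondegenerate hh)).symm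

lemma killingForm_repr (hh : h.IsCartanSubalgebra) (μ : Dual ℂ h) (s : h) :
    killingForm ℂ g ((repr hh μ : zero Γ) : g) ((s : zero Γ) : g) = μ s :=
  LinearMap.BilinForm.apply_toDual_symm_apply (hB := traceForm_nondegenerate hh) μ s

lemma lie_eq_killingForm_smul (hh : h.IsCartanSubalgebra) {μ : Dual ℂ h} {j : ZMod n} {e f : g}
    (he : e ∈ gr Γ h (μ, j)) (hf : f ∈ gr Γ h (-(μ, j))) :
    ⁅e, f⁆ = killingForm ℂ g e f • ((repr hh μ : zero Γ) : g) := by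
  have hef := lie_mem_weightSpace Γ h he hf
  obtain ⟨s, hs⟩ := mem_cartan hh (x := ⁅e, f⁆) (by simpa using hef.1)
    (fun t => by rw [hef.2 t]; simp)
  rw [← hs]
  have h1 : s - killingForm ℂ g e f • repr hh μ = 0 := by
    refine eq_zero_of_forall_cartan hh _ fun t => ?_
    change killingForm ℂ g (((s : zero Γ) : g) -
      killingForm ℂ g e f • ((repr hh μ : zero Γ) : g)) _ = 0
    have hft : ⁅f, ((t : zero Γ) : g)⁆ = μ t • f := by
      rw [← lie_skew, hf.2 t]; simp
    rw [map_sub, map_smul, LinearMap.sub_apply, LinearMap.smul_apply, killingForm_repr, hs,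
      killingForm_lie, hft, map_smul, smul_eq_mul, smul_eq_mul]
    ring
  have h2 := congrArg (fun x : h => ((x : zero Γ) : g)) (sub_eq_zero.mp h1)
  exact h2

/-- Every root vector `e` is completed by some `f` of opposite weight such that `[e, f]` is the
element of the Cartan subalgebra representing the weight. -/
lemma exists_lie_eq_repr (hh : h.IsCartanSubalgebra) {μ : Dual ℂ h} {j : ZMod n}
    (hp : gr Γ h (μ, j) ≠ ⊥) :
    ∃ e ∈ gr Γ h (μ, j), ∃ f ∈ gr Γ h (-(μ, j)), e ≠ 0 ∧ killingForm ℂ g e f = 1 ∧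
      ⁅e, f⁆ = ((repr hh μ : zero Γ) : g) := by
  obtain ⟨e, he, he0⟩ := Submodule.exists_mem_ne_zero_of_ne_bot hp
  obtain ⟨f, hf, hκ⟩ := exists_killingForm_ne_zero hh he he0
  have hf' : (killingForm ℂ g e f)⁻¹ • f ∈ gr Γ h (-(μ, j)) := Submodule.smul_mem _ _ hf
  have h1 : killingForm ℂ g e ((killingForm ℂ g e f)⁻¹ • f) = 1 := by
    rw [map_smul, smul_eq_mul, inv_mul_cancel₀ hκ]
  refine ⟨e, he, _, hf', he0, h1, ?_⟩
  rw [lie_eq_killingForm_smul hh he hf', h1, one_smul]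

lemma isString_weights (hh : h.IsCartanSubalgebra) {μ : Dual ℂ h} {j : ZMod n} {e f : g}
    (he : e ∈ gr Γ h (μ, j)) (hf : f ∈ gr Γ h (-(μ, j)))
    (hef : ⁅e, f⁆ = ((repr hh μ : zero Γ) : g)) (q : Dual ℂ h × ZMod n) :
    IsString e f (fun m : ℤ => gr Γ h (q + m • (μ, j)))
      (fun m : ℤ => q.1 (repr hh μ) + m * μ (repr hh μ)) where
  raise m x hx := by
    have := lie_mem_weightSpace Γ h he hx
    change ⁅e, x⁆ ∈ gr Γ h ((μ, j) + (q + m • (μ, j))) at this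
    rwa [show (μ, j) + (q + m • (μ, j)) = q + (m + 1) • (μ, j) by
      rw [add_smul, one_smul]; abel] at this
  lower m x hx := by
    have := lie_mem_weightSpace Γ h hf hx
    change ⁅f, x⁆ ∈ gr Γ h (-(μ, j) + (q + (m + 1) • (μ, j))) at this
    rwa [show -(μ, j) + (q + (m + 1) • (μ, j)) = q + m • (μ, j) by
      rw [add_smul, one_smul]; abel] at this
  scalar m x hx := by
    rw [hef, hx.2]
    simp

/-- The values of weights on the element representing a real weight `μ` are real multiples of the
value of `μ`, because the trace of this element on the string of `μ` through each weight is
zero. -/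
lemma exists_real_mul (hh : h.IsCartanSubalgebra) {μ : Dual ℂ h} {j : ZMod n}
    (hp : gr Γ h (μ, j) ≠ ⊥) (hμ : μ ≠ 0) {q : Dual ℂ h × ZMod n} (hq : gr Γ h q ≠ ⊥) :
    ∃ r : ℝ, q.1 (repr hh μ) = r * μ (repr hh μ) := by
  obtain ⟨e, he, f, hf, -, -, hef⟩ := exists_lie_eq_repr hh hp
  have hS := isString_weights hh he hf hef q
  obtain ⟨a, b, ha, hb⟩ := exists_weight_bounds (Γ := Γ) hμ q j
  have kill : ∀ m : ℤ, gr Γ h (q + m • (μ, j)) = ⊥ → ∀ x ∈ gr Γ h (q + m • (μ, j)), ⁅e, x⁆ = 0 := by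
    intro m hm x hx
    rw [hm, Submodule.mem_bot] at hx
    rw [hx, lie_zero]
  have ha0 : a < 0 := by
    by_contra h
    exact hq (by simpa using ha 0 (not_lt.mp h))
  have hb0 : 0 < b := by
    by_contra h
    exact hq (by simpa using hb 0 (not_lt.mp h))
  obtain ⟨k, rfl⟩ : ∃ k : ℕ, b = a + k := ⟨(b - a).toNat, by omega⟩
  have hsum := hS.sum_range a k
  rw [hS.tr_eq_zero (kill a (ha a le_rfl)), hS.tr_eq_zero (kill _ (hb _ le_rfl)), sub_zero] at hsum
  set d : ℕ → ℕ := fun i => finrank ℂ (gr Γ h (q + (a + i + 1) • (μ, j))) with hd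
  have hA : 0 < ∑ i ∈ Finset.range k, (d i : ℝ) := by
    refine Finset.sum_pos' (fun i _ => Nat.cast_nonneg _) ⟨(-a - 1).toNat, ?_, ?_⟩
    · rw [Finset.mem_range]; omega
    · have : a + ((-a - 1).toNat : ℤ) + 1 = 0 := by omega
      rw [Nat.cast_pos, hd]
      dsimp only
      rw [this, Nat.pos_iff_ne_zero]
      intro h0
      exact hq (by simpa using Submodule.finrank_eq_zero.mp h0)
  have hsum' : (∑ i ∈ Finset.range k, (d i : ℂ)) * q.1 (repr hh μ) +
      (∑ i ∈ Finset.range k, (d i : ℂ) * ((a + i + 1 : ℤ) : ℂ)) * μ (repr hh μ) = 0 := by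
    rw [← hsum, Finset.sum_mul, Finset.sum_mul, ← Finset.sum_add_distrib]
    refine Finset.sum_congr rfl fun i _ => ?_
    rw [mul_add, mul_assoc]
  have hA' : (∑ i ∈ Finset.range k, (d i : ℂ)) ≠ 0 := by
    have : ((∑ i ∈ Finset.range k, (d i : ℝ) : ℝ) : ℂ) ≠ 0 := by exact_mod_cast hA.ne'
    simpa using this
  refine ⟨-(∑ i ∈ Finset.range k, (d i : ℝ) * ((a + i + 1 : ℤ) : ℝ)) /
    ∑ i ∈ Finset.range k, (d i : ℝ), ?_⟩
  push_cast at hsum' ⊢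
  field_simp
  linear_combination hsum'

/-- The trace formula for the Killing form on the Cartan subalgebra of `g_0`. -/
lemma killingForm_cartan (hh : h.IsCartanSubalgebra) (t : h) :
    killingForm ℂ g ((t : zero Γ) : g) ((t : zero Γ) : g) =
      ∑ p ∈ (finite_weights Γ h).toFinset, (finrank ℂ (gr Γ h p) : ℂ) * (p.1 t) ^ 2 := by
  classical
  have hmaps : ∀ p : Dual ℂ h × ZMod n, Set.MapsTo (LieAlgebra.ad ℂ g ((t : zero Γ) : g) ∘ₗ
      LieAlgebra.ad ℂ g ((t : zero Γ) : g)) (gr Γ h p) (gr Γ h p) := by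
    intro p x hx
    change ⁅((t : zero Γ) : g), ⁅((t : zero Γ) : g), x⁆⁆ ∈ gr Γ h p
    rw [hx.2 t, lie_smul, hx.2 t]
    exact Submodule.smul_mem _ _ (Submodule.smul_mem _ _ hx)
  rw [killingForm_apply_apply, LinearMap.trace_eq_sum_trace_restrict' (isInternal_weightSpace hh)
    (finite_weights Γ h) hmaps]
  refine Finset.sum_congr rfl fun p _ => ?_
  have : (LieAlgebra.ad ℂ g ((t : zero Γ) : g) ∘ₗ
      LieAlgebra.ad ℂ g ((t : zero Γ) : g)).restrict (hmaps p) =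
      (p.1 t) ^ 2 • (LinearMap.id : gr Γ h p →ₗ[ℂ] gr Γ h p) := by
    ext x
    change ⁅((t : zero Γ) : g), ⁅((t : zero Γ) : g), (x : g)⁆⁆ = (p.1 t) ^ 2 • (x : g)
    rw [x.2.2 t, lie_smul, x.2.2 t, smul_smul, pow_two]
  rw [this, map_smul, LinearMap.trace_id, smul_eq_mul, mul_comm]

/-- Real weights have positive length. -/
lemma exists_pos_eq (hh : h.IsCartanSubalgebra) {μ : Dual ℂ h} {j : ZMod n}
    (hp : gr Γ h (μ, j) ≠ ⊥) (hμ : μ ≠ 0) : ∃ r : ℝ, 0 < r ∧ μ (repr hh μ) = r := by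
  classical
  have hreal : ∀ q : Dual ℂ h × ZMod n, ∃ r : ℝ,
      gr Γ h q ≠ ⊥ → q.1 (repr hh μ) = r * μ (repr hh μ) := by
    intro q
    by_cases hq : gr Γ h q = ⊥
    · exact ⟨0, fun h => absurd hq h⟩
    · obtain ⟨r, hr⟩ := exists_real_mul hh hp hμ hq
      exact ⟨r, fun _ => hr⟩
  choose r hr using hreal
  have hne : μ (repr hh μ) ≠ 0 := by
    intro h0
    have hzero : ((repr hh μ : zero Γ) : g) = 0 := by
      refine eq_zero_of_lie fun x => ?_
      have hx : x ∈ ⨆ p : Dual ℂ h × ZMod n, weightSpace Γ h p.1 p.2 := by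
        rw [iSup_weightSpace hh]; trivial
      induction hx using Submodule.iSup_induction' with
      | mem p x hx =>
        by_cases hbot : gr Γ h p = ⊥
        · have : x ∈ gr Γ h p := hx
          rw [hbot, Submodule.mem_bot] at this
          rw [this, lie_zero]
        · rw [hx.2, hr p hbot, h0, mul_zero, zero_smul]
      | zero => simp
      | add _ _ _ _ h h' => rw [lie_add, h, h', add_zero]
    refine hμ (LinearMap.ext fun s => ?_)
    rw [← killingForm_repr hh, hzero, map_zero]
    rfl
  set R : ℝ := ∑ p ∈ (finite_weights Γ h).toFinset, (finrank ℂ (gr Γ h p) : ℝ) * (r p) ^ 2 with hR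
  have hR0 : 0 ≤ R := Finset.sum_nonneg fun p _ => by positivity
  have heq : μ (repr hh μ) = R * μ (repr hh μ) ^ 2 := by
    conv_lhs => rw [← killingForm_repr hh μ (repr hh μ), killingForm_cartan hh]
    rw [hR, Complex.ofReal_sum, Finset.sum_mul]
    refine Finset.sum_congr rfl fun p hp => ?_
    rw [hr p (by simpa using hp)]
    push_cast
    ring
  have h1 : (R : ℂ) * μ (repr hh μ) = 1 := by
    have : μ (repr hh μ) * (R * μ (repr hh μ) - 1) = 0 := by linear_combination -heq
    exact sub_eq_zero.mp ((mul_eq_zero.mp this).resolve_left hne)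
  have hRne : R ≠ 0 := by
    rintro h0
    rw [h0] at h1
    simp at h1
  refine ⟨R⁻¹, inv_pos.mpr (lt_of_le_of_ne hR0 hRne.symm), ?_⟩
  have : (R : ℂ) ≠ 0 := by exact_mod_cast hRne
  push_cast
  field_simp
  linear_combination h1

/-- The real-valued inner product on the dual of the Cartan subalgebra: the real part of the form
dual to the Killing form of `g`. On weights the form itself takes real values. -/
noncomputable def ip (hh : h.IsCartanSubalgebra) : Dual ℂ h →+ Dual ℂ h →+ ℝ :=
  AddMonoidHom.mk' (fun μ => AddMonoidHom.mk' (fun ν => (ν (repr hh μ)).re)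
    fun ν ν' => by rw [LinearMap.add_apply, Complex.add_re])
    fun μ μ' => by
      ext ν
      simp

lemma ip_apply (hh : h.IsCartanSubalgebra) (μ ν : Dual ℂ h) :
    ip hh μ ν = (ν (repr hh μ)).re := rfl

/-- Multiplicity one: the trace of `[e, f]` on the span of `f`, `[e, f]` and the spaces of weights
`p, 2p, …` is zero, where `e` has weight `p`. -/
lemma finrank_le_one (hh : h.IsCartanSubalgebra) {μ : Dual ℂ h} {j : ZMod n}
    (hp : gr Γ h (μ, j) ≠ ⊥) (hμ : μ ≠ 0) : finrank ℂ (gr Γ h (μ, j)) ≤ 1 := by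
  obtain ⟨e, he, f, hf, he0, hκ, hef⟩ := exists_lie_eq_repr hh hp
  have hf0 : f ≠ 0 := by
    rintro rfl
    simp at hκ
  obtain ⟨r, hr, hμr⟩ := exists_pos_eq hh hp hμ
  have hS := isString_weights hh he hf hef 0
  set N : ℤ → Submodule ℂ g := fun m => if 1 ≤ m then gr Γ h (0 + m • (μ, j)) else
    if m = 0 then Submodule.span ℂ {⁅e, f⁆} else
      if m = -1 then Submodule.span ℂ {f} else ⊥ with hN
  have hN1 : ∀ m ≥ 1, N m = gr Γ h (0 + m • (μ, j)) := fun m hm => by simp [hN, hm.le]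
  have hN0 : N 0 = Submodule.span ℂ {⁅e, f⁆} := by simp [hN]
  have hNneg : N (-1) = Submodule.span ℂ {f} := by simp [hN]
  have hNbot : ∀ m ≤ -2, N m = ⊥ := fun m hm => by
    simp [hN, show ¬ 1 ≤ m by omega, show m ≠ 0 by omega, show m ≠ -1 by omega]
  have hle : ∀ m, N m ≤ gr Γ h (0 + m • (μ, j)) := by
    intro m
    rcases (by omega : 1 ≤ m ∨ m = 0 ∨ m = -1 ∨ m ≤ -2) with hm | rfl | rfl | hm
    · rw [hN1 m hm]
    · rw [hN0, Submodule.span_singleton_le_iff_mem]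
      have := hS.lower 0 e (by simpa using he)
      rw [← lie_skew]
      exact neg_mem this
    · rw [hNneg, Submodule.span_singleton_le_iff_mem]
      simpa using hf
    · rw [hNbot m hm]; exact bot_le
  have hfef : ⁅f, ⁅e, f⁆⁆ ∈ Submodule.span ℂ {f} := by
    rw [← lie_skew, hef, hf.2]
    exact neg_mem (Submodule.smul_mem _ _ (Submodule.mem_span_singleton_self f))
  have hS' : IsString e f N (fun m : ℤ => (0 : Dual ℂ h) (repr hh μ) + m * μ (repr hh μ)) := by
    refine ⟨fun m x hx => ?_, fun m x hx => ?_, fun m x hx => hS.scalar m x (hle m hx)⟩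
    · rcases (by omega : 0 ≤ m ∨ m = -1 ∨ m ≤ -2) with hm | rfl | hm
      · rw [hN1 _ (by omega)]
        exact hS.raise m x (hle m hx)
      · rw [hNneg] at hx
        obtain ⟨c, rfl⟩ := Submodule.mem_span_singleton.mp hx
        rw [show (-1 : ℤ) + 1 = 0 by norm_num, hN0, lie_smul]
        exact Submodule.smul_mem _ _ (Submodule.mem_span_singleton_self _)
      · rw [hNbot m hm, Submodule.mem_bot] at hx
        rw [hx, lie_zero]
        exact zero_mem _
    · rcases (by omega : 1 ≤ m ∨ m = 0 ∨ m = -1 ∨ m = -2 ∨ m < -2) with hm | rfl | rfl | rfl | hm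
      · rw [hN1 m hm]
        exact hS.lower m x (hle _ hx)
      · have hx' : x ∈ gr Γ h (μ, j) := by simpa using hle _ hx
        rw [hN0, ← lie_skew f x, lie_eq_killingForm_smul hh hx' hf, hef]
        exact neg_mem (Submodule.smul_mem _ _ (Submodule.mem_span_singleton_self _))
      · rw [show (-1 : ℤ) + 1 = 0 by norm_num, hN0] at hx
        obtain ⟨c, rfl⟩ := Submodule.mem_span_singleton.mp hx
        rw [hNneg, lie_smul]
        exact Submodule.smul_mem _ _ hfef
      · rw [show (-2 : ℤ) + 1 = -1 by norm_num, hNneg] at hx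
        obtain ⟨c, rfl⟩ := Submodule.mem_span_singleton.mp hx
        rw [lie_smul, lie_self, smul_zero]
        exact zero_mem _
      · rw [hNbot (m + 1) (by omega), Submodule.mem_bot] at hx
        rw [hx, lie_zero]
        exact zero_mem _
  obtain ⟨-, b, -, hb⟩ := exists_weight_bounds (Γ := Γ) hμ 0 j
  set k : ℕ := b.toNat + 5 with hk
  have hsum := hS'.sum_range_re (a := -2) (k := k)
    (fun x hx => by
      rw [hNbot _ le_rfl, Submodule.mem_bot] at hx
      rw [hx, lie_zero])
    (fun x hx => by
      have := hle _ hx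
      rw [hb _ (by omega), Submodule.mem_bot] at this
      rw [this, lie_zero])
  rw [hk, Finset.sum_range_succ', Finset.sum_range_succ', Finset.sum_range_succ'] at hsum
  have hrest : 0 ≤ ∑ i ∈ Finset.range (b.toNat + 2),
      (finrank ℂ (N (-2 + ((i + 1 + 1 + 1 : ℕ) : ℤ) + 1)) : ℝ) *
        ((0 : Dual ℂ h) (repr hh μ) + ((-2 + ((i + 1 + 1 + 1 : ℕ) : ℤ) + 1 : ℤ) : ℂ) *
          μ (repr hh μ)).re := by
    refine Finset.sum_nonneg fun i _ => mul_nonneg (Nat.cast_nonneg _) ?_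
    rw [hμr, LinearMap.zero_apply, zero_add, ← Complex.ofReal_intCast, ← Complex.ofReal_mul,
      Complex.ofReal_re]
    refine mul_nonneg ?_ hr.le
    push_cast
    linarith [(Nat.cast_nonneg i : (0 : ℝ) ≤ i)]
  have e1 : (-2 + ((1 + 1 : ℕ) : ℤ) + 1) = 1 := by norm_num
  have e2 : (-2 + ((0 + 1 : ℕ) : ℤ) + 1) = 0 := by norm_num
  have e3 : (-2 + ((0 : ℕ) : ℤ) + 1) = -1 := by norm_num
  have e4 : finrank ℂ (N (-1)) = 1 := by rw [hNneg]; exact finrank_span_singleton hf0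
  have e5 : N 1 = gr Γ h (μ, j) := by rw [hN1 1 le_rfl, one_smul, zero_add]
  have e6 : (-2 + ((0 + 1 + 1 : ℕ) : ℤ) + 1) = 1 := by norm_num
  rw [e6, e2, e3, e4, e5, hμr] at hsum
  simp only [LinearMap.zero_apply, Int.cast_one, one_mul, Complex.ofReal_re, zero_add,
    Int.cast_zero, zero_mul, Complex.zero_re, mul_zero, add_zero, Nat.cast_one, Int.cast_neg,
    neg_mul, Complex.neg_re] at hsum
  rw [hμr] at hrest
  simp only [LinearMap.zero_apply, zero_add] at hrest
  have hfin : (finrank ℂ (gr Γ h (μ, j)) : ℝ) * r ≤ 1 * r := by linarith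
  exact_mod_cast le_of_mul_le_mul_right hfin hr

theorem isRootGrading (hh : h.IsCartanSubalgebra) : IsRootGrading (gr Γ h) (ip hh) where
  lie_mem p q x hx y hy := lie_mem_weightSpace Γ h hx hy
  finite := finite_weights Γ h
  pos p hp hp0 := by
    obtain ⟨r, hr, hμr⟩ := exists_pos_eq hh hp hp0
    rw [ip_apply, hμr]
    exact hr
  triple p hp hp0 := by
    obtain ⟨e, he, f, hf, -, -, hef⟩ := exists_lie_eq_repr hh hp
    refine ⟨e, f, he, hf, fun q x hx => ?_⟩
    by_cases hq : gr Γ h q = ⊥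
    · rw [hq, Submodule.mem_bot] at hx
      rw [hx, lie_zero, smul_zero]
    obtain ⟨r, hr, hμr⟩ := exists_pos_eq hh hp hp0
    obtain ⟨r', hr'⟩ := exists_real_mul hh hp hp0 hq
    rw [hef, hx.2, ip_apply, hr', hμr, ← Complex.ofReal_mul, Complex.ofReal_re]
  line p hp hp0 x hx hx0 y hy := by
    have h1 : finrank ℂ (gr Γ h p) = 1 := by
      refine le_antisymm (finrank_le_one hh hp hp0) ?_
      rw [Nat.one_le_iff_ne_zero]
      exact fun h0 => hp (Submodule.finrank_eq_zero.mp h0)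
    obtain ⟨c, hc⟩ := exists_smul_eq_of_finrank_eq_one h1 (x := (⟨x, hx⟩ : gr Γ h p))
      (fun h0 => hx0 (congrArg Subtype.val h0)) ⟨y, hy⟩
    exact ⟨c, (congrArg Subtype.val hc).symm⟩

end Instance

/-! ### The centralizer of the Cartan subalgebra of `g_0` is abelian -/

section Centralizer

variable {n : ℕ} {g : Type*} [LieRing g] [LieAlgebra ℂ g]

/-- The derived algebra of a Lie subalgebra, again as a subalgebra of the ambient algebra. -/
def derived (D : LieSubalgebra ℂ g) : LieSubalgebra ℂ g :=
  { Submodule.span ℂ {z | ∃ x ∈ D, ∃ y ∈ D, ⁅x, y⁆ = z} with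
    lie_mem' := fun {x y} hx hy => by
      have hle : Submodule.span ℂ {z | ∃ x ∈ D, ∃ y ∈ D, ⁅x, y⁆ = z} ≤ D.toSubmodule := by
        refine Submodule.span_le.mpr ?_
        rintro _ ⟨x, hx, y, hy, rfl⟩
        exact D.lie_mem hx hy
      exact Submodule.subset_span ⟨x, hle hx, y, hle hy, rfl⟩ }

lemma lie_mem_derived {D : LieSubalgebra ℂ g} {x y : g} (hx : x ∈ D) (hy : y ∈ D) :
    ⁅x, y⁆ ∈ derived D :=
  Submodule.subset_span ⟨x, hx, y, hy, rfl⟩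

lemma derived_le_iff {D : LieSubalgebra ℂ g} {N : Submodule ℂ g} :
    (derived D).toSubmodule ≤ N ↔ ∀ x ∈ D, ∀ y ∈ D, ⁅x, y⁆ ∈ N := by
  refine ⟨fun h x hx y hy => h (lie_mem_derived hx hy), fun h => Submodule.span_le.mpr ?_⟩
  rintro _ ⟨x, hx, y, hy, rfl⟩
  exact h x hx y hy

lemma derived_le (D : LieSubalgebra ℂ g) : derived D ≤ D :=
  derived_le_iff.mpr fun _ hx _ hy => D.lie_mem hx hy

variable {Γ : ZMod n → Submodule ℂ g} [GradedLieAlgebra Γ] {h : LieSubalgebra ℂ (zero Γ)}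

variable (h) in
/-- The derived series of the centralizer of `h` in `g`. -/
def centralizerSeries : ℕ → LieSubalgebra ℂ g
  | 0 =>
    { carrier := {x | ∀ t : h, ⁅((t : zero Γ) : g), x⁆ = 0}
      add_mem' := fun ha hb t => by rw [lie_add, ha t, hb t, add_zero]
      zero_mem' := fun t => lie_zero _
      smul_mem' := fun c a ha t => by rw [lie_smul, ha t, smul_zero]
      lie_mem' := fun ha hb t => by rw [leibniz_lie, ha t, hb t, zero_lie, lie_zero, add_zero] }
  | k + 1 => derived (centralizerSeries k)

lemma centralizerSeries_le_zero (k : ℕ) : centralizerSeries h k ≤ centralizerSeries h 0 := by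
  induction k with
  | zero => exact le_rfl
  | succ k ih => exact (derived_le _).trans ih

lemma lie_mem_centralizerSeries (k : ℕ) {x y : g} (hx : x ∈ centralizerSeries h 0)
    (hy : y ∈ centralizerSeries h k) : ⁅x, y⁆ ∈ centralizerSeries h k := by
  induction k generalizing y with
  | zero => exact LieSubalgebra.lie_mem _ hx hy
  | succ k ih =>
    have : (derived (centralizerSeries h k)).toSubmodule ≤
        (derived (centralizerSeries h k)).toSubmodule.comap (LieAlgebra.ad ℂ g x) := by
      refine derived_le_iff.mpr fun u hu v hv => ?_
      rw [Submodule.mem_comap, LieAlgebra.ad_apply, leibniz_lie]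
      exact add_mem (lie_mem_derived (ih hu) hv) (lie_mem_derived hu (ih hv))
    exact this hy

lemma mem_weightSpace_zero {x : g} (hx : x ∈ centralizerSeries h 0) {j : ZMod n} (hj : x ∈ Γ j) :
    x ∈ gr Γ h (0, j) :=
  ⟨hj, fun t => by rw [hx t]; simp⟩

variable [NeZero n]

lemma comp_mem_centralizerSeries (k : ℕ) {x : g} (hx : x ∈ centralizerSeries h k) (j : ZMod n) :
    comp Γ j x ∈ centralizerSeries h k := by
  induction k generalizing x j with
  | zero =>
    intro t
    have := (comp_mem_weightSpace (μ := (0 : Dual ℂ h)) (x := x)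
      (fun t => by rw [hx t]; simp) j).2 t
    simpa using this
  | succ k ih =>
    have : (derived (centralizerSeries h k)).toSubmodule ≤
        (derived (centralizerSeries h k)).toSubmodule.comap (comp Γ j) := by
      refine derived_le_iff.mpr fun u hu v hv => ?_
      rw [Submodule.mem_comap, ← sum_comp Γ u, sum_lie, map_sum]
      refine sum_mem fun i _ => ?_
      rw [comp_lie (comp_mem Γ i u)]
      exact lie_mem_derived (ih hu i) (ih hv _)
    exact this hx

lemma lie_eq_zero_of_homogeneous {D D' : LieSubalgebra ℂ g} (hD : ∀ x ∈ D, ∀ j, comp Γ j x ∈ D)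
    (hD' : ∀ x ∈ D', ∀ j, comp Γ j x ∈ D')
    (hlie : ∀ i j, ∀ x ∈ D, x ∈ Γ i → ∀ y ∈ D', y ∈ Γ j → ⁅x, y⁆ = 0) {x y : g} (hx : x ∈ D)
    (hy : y ∈ D') : ⁅x, y⁆ = 0 := by
  rw [← sum_comp Γ x, ← sum_comp Γ y, sum_lie]
  refine Finset.sum_eq_zero fun i _ => ?_
  rw [lie_sum]
  exact Finset.sum_eq_zero fun j _ =>
    hlie i j _ (hD x hx i) (comp_mem Γ i x) _ (hD' y hy j) (comp_mem Γ j y)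

variable [FiniteDimensional ℂ g]

/-- By Kreknin's theorem, the centralizer of the Cartan subalgebra of `g_0` is solvable. -/
lemma exists_centralizerSeries_eq_bot (hh : h.IsCartanSubalgebra) :
    ∃ k, ∀ x ∈ centralizerSeries h k, x = 0 := by
  obtain ⟨k, hk⟩ : ∃ k, ∀ l, finrank ℂ (centralizerSeries h k).toSubmodule ≤
      finrank ℂ (centralizerSeries h l).toSubmodule := by
    obtain ⟨_, ⟨k, rfl⟩, hk⟩ := wellFounded_lt.has_min
      (Set.range fun k => finrank ℂ (centralizerSeries h k).toSubmodule) ⟨_, 0, rfl⟩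
    exact ⟨k, fun l => not_lt.mp (hk _ ⟨l, rfl⟩)⟩
  have heq : (centralizerSeries h (k + 1)).toSubmodule = (centralizerSeries h k).toSubmodule :=
    Submodule.eq_of_le_of_finrank_le (derived_le _) (hk (k + 1))
  refine ⟨k, fun x hx => eq_bot_of_perfect (Γ := Γ) (centralizerSeries h k)
    (fun x hx j => comp_mem_centralizerSeries k hx j) heq.ge (fun x hx hx0 y hy => ?_) hx⟩
  obtain ⟨s, rfl⟩ := mem_cartan hh hx0 (centralizerSeries_le_zero k hx)
  exact centralizerSeries_le_zero k hy s

variable [LieAlgebra.IsKilling ℂ g]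

/-- A homogeneous element of the centralizer of the Cartan subalgebra which is `ad`-nilpotent is
zero: it commutes with the elements of opposite degree, hence is orthogonal to them. -/
lemma eq_zero_of_isNilpotent_centralizer (hh : h.IsCartanSubalgebra) {x : g} {j : ZMod n}
    (hx : x ∈ gr Γ h (0, j)) (hnil : IsNilpotent (LieAlgebra.ad ℂ g x)) : x = 0 := by
  by_contra hx0
  obtain ⟨y, hy, hκ⟩ := exists_killingForm_ne_zero hh hx hx0
  refine hκ ?_
  have hxy : ⁅x, y⁆ = 0 := by
    rw [lie_eq_killingForm_smul hh hx hy, map_zero]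
    simp
  rw [killingForm_apply_apply]
  exact (LinearMap.isNilpotent_trace_of_isNilpotent
    ((commute_ad hxy).isNilpotent_mul_right hnil)).eq_zero

/-- The centralizer of the Cartan subalgebra of `g_0` is abelian. It is solvable, and the brackets
which give the last non-zero term of its derived series are `ad`-nilpotent, hence zero. -/
theorem lie_eq_zero_of_weight_zero (hh : h.IsCartanSubalgebra) {x y : g} {i j : ZMod n}
    (hx : x ∈ gr Γ h (0, i)) (hy : y ∈ gr Γ h (0, j)) : ⁅x, y⁆ = 0 := by
  have step : ∀ k, (∀ x ∈ centralizerSeries h (k + 2), x = 0) →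
      ∀ x ∈ centralizerSeries h (k + 1), x = 0 := by
    intro k hk
    have hE : ∀ x ∈ centralizerSeries h (k + 1), ∀ y ∈ centralizerSeries h (k + 1), ⁅x, y⁆ = 0 :=
      fun x hx y hy => hk _ (lie_mem_derived hx hy)
    have hcentral : ∀ x ∈ centralizerSeries h 0, ∀ y ∈ centralizerSeries h (k + 1), ⁅x, y⁆ = 0 := by
      intro x hx y hy
      refine lie_eq_zero_of_homogeneous (Γ := Γ) (fun x hx j => comp_mem_centralizerSeries 0 hx j)
        (fun x hx j => comp_mem_centralizerSeries (k + 1) hx j) ?_ hx hy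
      intro i j x hx hxi y hy hyj
      have hxy := lie_mem_centralizerSeries (k + 1) hx hy
      refine eq_zero_of_isNilpotent_centralizer hh
        (mem_weightSpace_zero (centralizerSeries_le_zero _ hxy) (lie_mem_component hxi hyj))
        (isNilpotent_ad_lie ?_ (hE _ hxy _ hy))
      refine hE _ hxy _ ?_
      rw [← lie_skew]
      exact neg_mem (lie_mem_centralizerSeries (k + 1) hx hxy)
    have habelian : ∀ x ∈ centralizerSeries h k, ∀ y ∈ centralizerSeries h k, ⁅x, y⁆ = 0 := by
      intro x hx y hy
      refine lie_eq_zero_of_homogeneous (Γ := Γ) (fun x hx j => comp_mem_centralizerSeries k hx j)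
        (fun x hx j => comp_mem_centralizerSeries k hx j) ?_ hx hy
      intro i j x hx hxi y hy hyj
      have hxy : ⁅x, y⁆ ∈ centralizerSeries h (k + 1) := lie_mem_derived hx hy
      have hx' := hcentral x (centralizerSeries_le_zero k hx) _ hxy
      have hy' := hcentral y (centralizerSeries_le_zero k hy) _ hxy
      refine eq_zero_of_isNilpotent_centralizer hh
        (mem_weightSpace_zero (centralizerSeries_le_zero _ hxy) (lie_mem_component hxi hyj))
        (isNilpotent_ad_lie ?_ ?_)
      · rw [← lie_skew ⁅x, y⁆ x, hx', neg_zero, lie_zero]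
      · rw [← lie_skew, hy', neg_zero]
    intro x hx
    have : (centralizerSeries h (k + 1)).toSubmodule ≤ ⊥ :=
      derived_le_iff.mpr fun x hx y hy => by rw [habelian x hx y hy]; exact zero_mem _
    exact (Submodule.mem_bot ℂ).mp (this hx)
  have h1 : ∀ x ∈ centralizerSeries h 1, x = 0 := by
    obtain ⟨k, hk⟩ := exists_centralizerSeries_eq_bot hh
    replace hk : ∀ x ∈ centralizerSeries h (k + 1), x = 0 := fun x hx => hk x (derived_le _ hx)
    induction k with
    | zero => exact hk
    | succ k ih => exact ih (step k hk)
  have hz : ∀ {x : g} {i : ZMod n}, x ∈ gr Γ h (0, i) → x ∈ centralizerSeries h 0 :=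
    fun hx t => by rw [hx.2 t]; simp
  exact h1 _ (lie_mem_derived (hz hx) (hz hy))

end Centralizer

/-! ### Positive roots and the order on graded weights -/

section Borel

variable {n : ℕ} {g : Type*} [LieRing g] [LieAlgebra ℂ g]
  {Γ : ZMod n → Submodule ℂ g} [GradedLieAlgebra Γ] {h b : LieSubalgebra ℂ (zero Γ)}

variable (b) in
/-- A subalgebra of `g_0`, as a subspace of `g`. -/
def image : Submodule ℂ g := b.toSubmodule.map (zero Γ).toSubmodule.subtype

lemma image_le : image b ≤ Γ 0 := by
  rintro _ ⟨y, -, rfl⟩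
  exact y.2

lemma lie_mem_image {x y : g} (hx : x ∈ image b) (hy : y ∈ image b) : ⁅x, y⁆ ∈ image b := by
  obtain ⟨(x : zero Γ), hx, rfl⟩ := hx
  obtain ⟨(y : zero Γ), hy, rfl⟩ := hy
  exact ⟨(⁅x, y⁆ : zero Γ), b.lie_mem hx hy, rfl⟩

lemma gr_le_image {α : Dual ℂ h} (hα : α ∈ posRoots Γ h b) : gr Γ h (α, 0) ≤ image b :=
  fun x hx => ⟨⟨x, hx.1⟩, hα.2 ⟨x, hx.1⟩ hx, rfl⟩

lemma mem_posRoots {α : Dual ℂ h} (hα : gr Γ h (α, 0) ≠ ⊥) (hα0 : α ≠ 0)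
    (hle : gr Γ h (α, 0) ≤ image b) : α ∈ posRoots Γ h b := by
  refine ⟨⟨hα, hα0⟩, fun x hx => ?_⟩
  obtain ⟨y, hy, hyx⟩ := hle hx
  exact (Subtype.ext hyx : y = x) ▸ hy

lemma gr_ne_bot_of_posRoot {α : Dual ℂ h} (hα : α ∈ posRoots Γ h b) : gr Γ h (α, 0) ≠ ⊥ :=
  hα.1.1

lemma eq_zero_of_mem_of_mem {i j : ZMod n} (hij : i ≠ j) {x : g} (hi : x ∈ Γ i) (hj : x ∈ Γ j) :
    x = 0 := by
  rw [← comp_of_mem Γ hj, comp_of_mem_ne Γ hi hij]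

lemma snd_eq_zero_of_le_image {c : Dual ℂ h × ZMod n} (hc : gr Γ h c ≠ ⊥)
    (hle : gr Γ h c ≤ image b) : c.2 = 0 := by
  obtain ⟨x, hx, hx0⟩ := Submodule.exists_mem_ne_zero_of_ne_bot hc
  by_contra h0
  exact hx0 (eq_zero_of_mem_of_mem h0 hx.1 (image_le (hle hx)))

lemma GLE.refl (p : Dual ℂ h × ZMod n) : GLE Γ h b p p :=
  ⟨rfl, by rw [sub_self]; exact zero_mem _⟩

lemma GLE.trans {p q r : Dual ℂ h × ZMod n} (hpq : GLE Γ h b p q) (hqr : GLE Γ h b q r) :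
    GLE Γ h b p r :=
  ⟨hpq.1.trans hqr.1, by rw [← sub_add_sub_cancel]; exact add_mem hqr.2 hpq.2⟩

lemma GLE.add {p q p' q' : Dual ℂ h × ZMod n} (hp : GLE Γ h b p q) (hp' : GLE Γ h b p' q') :
    GLE Γ h b (p + p') (q + q') :=
  ⟨by rw [Prod.snd_add, Prod.snd_add, hp.1, hp'.1], by
    rw [Prod.fst_add, Prod.fst_add, add_sub_add_comm]; exact add_mem hp.2 hp'.2⟩

lemma GLE.nsmul {p q : Dual ℂ h × ZMod n} (hp : GLE Γ h b p q) (s : ℕ) :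
    GLE Γ h b (s • p) (s • q) := by
  induction s with
  | zero => rw [zero_smul, zero_smul]; exact GLE.refl _
  | succ s ih => rw [succ_nsmul, succ_nsmul]; exact ih.add hp

/-- A finite non-empty set has maximal elements with respect to a partial order. -/
lemma exists_maximal_of_finite {ι : Type*} (r : ι → ι → Prop) (hrefl : ∀ x, r x x)
    (htrans : ∀ x y z, r x y → r y z → r x z) (hantisymm : ∀ x y, r x y → r y x → x = y)
    {s : Set ι} (hs : s.Finite) {a : ι} (ha : a ∈ s) :
    ∃ m ∈ s, r a m ∧ ∀ x ∈ s, r m x → x = m := by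
  let _ : PartialOrder ι :=
    { le := r, le_refl := hrefl, le_trans := htrans, le_antisymm := hantisymm }
  obtain ⟨m, ham, hm⟩ := hs.exists_le_maximal ha
  exact ⟨m, hm.1, ham, fun x hx hmx => (hm.eq_of_le hx hmx).symm⟩

variable [FiniteDimensional ℂ g]

variable (Γ h) in
lemma finite_roots : (roots Γ h).Finite := by
  refine ((finite_weights Γ h).image Prod.fst).subset ?_
  intro α hα
  exact ⟨(α, 0), hα.1, rfl⟩

variable [NeZero n] [LieAlgebra.IsKilling ℂ g]

/-- A solvable subalgebra of `g_0` does not contain two opposite root spaces, as these would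
generate a perfect subalgebra. -/
lemma add_ne_zero_of_solvable (hh : h.IsCartanSubalgebra) (hb : LieAlgebra.IsSolvable b)
    {c p : Dual ℂ h × ZMod n} (hc : gr Γ h c ≠ ⊥) (hc0 : c.1 ≠ 0) (hcb : gr Γ h c ≤ image b)
    (hp : gr Γ h p ≠ ⊥) (hpb : gr Γ h p ≤ image b) : c.1 + p.1 ≠ 0 := by
  intro hcp
  have hpc : p = -c := by
    refine Prod.ext (neg_eq_of_add_eq_zero_right hcp).symm ?_
    rw [snd_eq_zero_of_le_image hp hpb, Prod.snd_neg, snd_eq_zero_of_le_image hc hcb, neg_zero]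
  subst hpc
  have hG := isRootGrading (Γ := Γ) hh
  obtain ⟨e, f, ht⟩ := hG.triple c hc hc0
  have hpos := hG.pos c hc hc0
  obtain ⟨E, hE, rfl⟩ := hcb ht.mem
  obtain ⟨F, hF, rfl⟩ := hpb ht.mem_neg
  set r : ℂ := (ip hh c.1 c.1 : ℂ) with hr
  have hr0 : r ≠ 0 := by rw [hr]; exact_mod_cast hpos.ne'
  let E' : b := ⟨E, hE⟩
  let F' : b := ⟨F, hF⟩
  have h1 : ⁅⁅E', F'⁆, E'⁆ = r • E' :=
    Subtype.ext (Subtype.ext (ht.scalar c _ ht.mem))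
  have h2 : ⁅⁅E', F'⁆, F'⁆ = (-r) • F' := by
    refine Subtype.ext (Subtype.ext ((ht.scalar (-c) _ ht.mem_neg).trans ?_))
    rw [Prod.fst_neg, map_neg, Complex.ofReal_neg]
    rfl
  have key : ∀ k, E' ∈ LieAlgebra.derivedSeries ℂ b k ∧ F' ∈ LieAlgebra.derivedSeries ℂ b k := by
    intro k
    induction k with
    | zero => exact ⟨trivial, trivial⟩
    | succ k ih =>
      have hT : ⁅E', F'⁆ ∈ LieAlgebra.derivedSeries ℂ b k := LieSubmodule.lie_mem _ ih.2
      have hsucc : ∀ x ∈ LieAlgebra.derivedSeries ℂ b k, ∀ y ∈ LieAlgebra.derivedSeries ℂ b k,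
          ⁅x, y⁆ ∈ LieAlgebra.derivedSeries ℂ b (k + 1) := by
        intro x hx y hy
        rw [LieAlgebra.derivedSeries_def, LieAlgebra.derivedSeriesOfIdeal_succ]
        exact LieSubmodule.lie_mem_lie hx hy
      have h1' := hsucc _ hT _ ih.1
      have h2' := hsucc _ hT _ ih.2
      rw [h1] at h1'
      rw [h2] at h2'
      exact ⟨(Submodule.smul_mem_iff _ hr0).mp h1',
        (Submodule.smul_mem_iff _ (neg_ne_zero.mpr hr0)).mp h2'⟩
  obtain ⟨k, hk⟩ := LieAlgebra.IsSolvable.solvable ℂ b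
  have hE0 := (key k).1
  rw [hk, LieSubmodule.mem_bot] at hE0
  have hE0' : (zero Γ).subtype E = 0 := congrArg (fun x : b => ((x : zero Γ) : g)) hE0
  obtain ⟨x, hx, hx0⟩ := Submodule.exists_mem_ne_zero_of_ne_bot hc
  have h3 := ht.scalar c x hx
  rw [hE0', zero_lie, zero_lie] at h3
  exact (smul_ne_zero hr0 hx0) h3.symm

/-- A non-empty sum of positive roots is not zero. -/
lemma sum_posRoots_ne_zero (hh : h.IsCartanSubalgebra) (hb : LieAlgebra.IsSolvable b)
    (s : Multiset (Dual ℂ h)) (hs0 : s ≠ 0) (hs : ∀ α ∈ s, α ∈ posRoots Γ h b) : s.sum ≠ 0 := by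
  have hG := isRootGrading (Γ := Γ) hh
  have := (hG.sum_mem_filtration (F := fun _ => image b)
    (fun _ _ x hx y hy => lie_mem_image hx hy)
    (fun c c' _ _ hc hc0 hcb hc' _ hc'b => add_ne_zero_of_solvable hh hb hc hc0 hcb hc' hc'b)
    (s.map fun α => ((α, 0), 0)) (by simpa using hs0) (fun a ha => by
      obtain ⟨α, hα, rfl⟩ := Multiset.mem_map.mp ha
      exact ⟨gr_ne_bot_of_posRoot (hs α hα), (hs α hα).1.2, gr_le_image (hs α hα)⟩)).1
  have hsum : ((s.map fun α => (((α, 0), 0) : (Dual ℂ h × ZMod n) × ℕ)).sum).1.1 = s.sum := by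
    have := map_multiset_sum ((AddMonoidHom.fst (Dual ℂ h) (ZMod n)).comp
      (AddMonoidHom.fst (Dual ℂ h × ZMod n) ℕ)) (s.map fun α => ((α, 0), 0))
    rw [Multiset.map_map] at this
    simpa using this
  rwa [hsum] at this

lemma eq_zero_of_mem_closure (hh : h.IsCartanSubalgebra) (hb : LieAlgebra.IsSolvable b)
    {x : Dual ℂ h} (hx : x ∈ AddSubmonoid.closure (posRoots Γ h b))
    (hx' : -x ∈ AddSubmonoid.closure (posRoots Γ h b)) : x = 0 := by
  obtain ⟨s, hs, rfl⟩ := AddSubmonoid.exists_multiset_of_mem_closure hx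
  obtain ⟨t, ht, hts⟩ := AddSubmonoid.exists_multiset_of_mem_closure hx'
  by_contra hne
  refine sum_posRoots_ne_zero hh hb (s + t) (fun h0 => hne ?_) (fun α hα => ?_) ?_
  · rw [(add_eq_zero.mp h0).1, Multiset.sum_zero]
  · exact (Multiset.mem_add.mp hα).elim (hs α) (ht α)
  · rw [Multiset.sum_add, hts, add_neg_cancel]

/-- Each positive root is a sum of simple roots: a minimal counterexample would be the sum of two
smaller positive roots. -/
lemma posRoots_subset_rootCone (hh : h.IsCartanSubalgebra) (hb : LieAlgebra.IsSolvable b)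
    {α : Dual ℂ h} (hα : α ∈ posRoots Γ h b) : α ∈ rootCone Γ h b := by
  by_contra hcone
  set C := AddSubmonoid.closure (posRoots Γ h b) with hC
  have hfin : {β | β ∈ posRoots Γ h b ∧ β ∉ rootCone Γ h b}.Finite :=
    (finite_roots Γ h).subset fun β hβ => hβ.1.1
  obtain ⟨m, ⟨hm, hmc⟩, -, hmax⟩ := exists_maximal_of_finite (fun x y => x - y ∈ C)
    (fun x => by rw [sub_self]; exact zero_mem _)
    (fun x y z hxy hyz => by rw [← sub_add_sub_cancel]; exact add_mem hxy hyz)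
    (fun x y hxy hyx => sub_eq_zero.mp
      (eq_zero_of_mem_closure hh hb hxy (by rwa [neg_sub]))) hfin ⟨hα, hcone⟩
  have hms : m ∉ simpleRoots Γ h b := fun h => hmc (AddSubmonoid.subset_closure h)
  obtain ⟨β, hβ, γ, hγ, hmβγ⟩ : ∃ β ∈ posRoots Γ h b, ∃ γ ∈ posRoots Γ h b, m = β + γ := by
    by_contra! hcon
    exact hms ⟨hm, hcon⟩
  have hβm : m - β ∈ C := by
    rw [hmβγ, add_sub_cancel_left]; exact AddSubmonoid.subset_closure hγ
  have hγm : m - γ ∈ C := by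
    rw [hmβγ, add_sub_cancel_right]; exact AddSubmonoid.subset_closure hβ
  by_cases hβc : β ∈ rootCone Γ h b
  · by_cases hγc : γ ∈ rootCone Γ h b
    · exact hmc (hmβγ ▸ add_mem hβc hγc)
    · have := hmax γ ⟨hγ, hγc⟩ hγm
      rw [hmβγ, right_eq_add] at this
      exact hβ.1.2 this
  · have := hmax β ⟨hβ, hβc⟩ hβm
    rw [hmβγ, left_eq_add] at this
    exact hγ.1.2 this

lemma GLE.antisymm (hh : h.IsCartanSubalgebra) (hb : LieAlgebra.IsSolvable b)
    {p q : Dual ℂ h × ZMod n} (hpq : GLE Γ h b p q) (hqp : GLE Γ h b q p) : p = q := by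
  have hle : rootCone Γ h b ≤ AddSubmonoid.closure (posRoots Γ h b) :=
    AddSubmonoid.closure_mono fun α hα => hα.1
  refine Prod.ext (sub_eq_zero.mp ?_).symm hpq.1
  exact eq_zero_of_mem_closure hh hb (hle hpq.2) (by rw [neg_sub]; exact hle hqp.2)

lemma exists_maximal (hh : h.IsCartanSubalgebra) (hb : LieAlgebra.IsSolvable b)
    {s : Set (Dual ℂ h × ZMod n)} (hs : s.Finite) {p : Dual ℂ h × ZMod n} (hp : p ∈ s) :
    ∃ m ∈ s, GLE Γ h b p m ∧ ∀ q ∈ s, GLE Γ h b m q → q = m :=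
  exists_maximal_of_finite _ GLE.refl (fun _ _ _ => GLE.trans) (fun _ _ => GLE.antisymm hh hb) hs hp

lemma exists_minimal (hh : h.IsCartanSubalgebra) (hb : LieAlgebra.IsSolvable b)
    {s : Set (Dual ℂ h × ZMod n)} (hs : s.Finite) {p : Dual ℂ h × ZMod n} (hp : p ∈ s) :
    ∃ m ∈ s, GLE Γ h b m p ∧ ∀ q ∈ s, GLE Γ h b q m → q = m :=
  exists_maximal_of_finite (fun p q => GLE Γ h b q p) GLE.refl (fun _ _ _ hxy hyz => hyz.trans hxy)
    (fun _ _ hxy hyx => GLE.antisymm hh hb hyx hxy) hs hp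

lemma exists_isHighestWeight (hh : h.IsCartanSubalgebra) (hb : LieAlgebra.IsSolvable b)
    {p : Dual ℂ h × ZMod n} (hp : gr Γ h p ≠ ⊥) :
    ∃ l, IsHighestWeight Γ h b l p.2 ∧ GLE Γ h b p (l, p.2) := by
  obtain ⟨⟨l, j⟩, hm, hle, hmax⟩ := exists_maximal hh hb (finite_weights Γ h) hp
  obtain rfl : p.2 = j := hle.1
  obtain ⟨v, hv, hv0⟩ := Submodule.exists_mem_ne_zero_of_ne_bot hm
  refine ⟨l, ⟨v, hv, hv0, fun α hα e he => ?_⟩, hle⟩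
  by_contra hne
  have hmem := lie_mem_weightSpace Γ h he hv
  have heq := hmax (α + l, 0 + p.2) ((Submodule.ne_bot_iff _).mpr ⟨_, hmem, hne⟩)
    ⟨(zero_add _).symm, by
      rw [add_sub_cancel_right]; exact posRoots_subset_rootCone hh hb hα⟩
  have := congrArg Prod.fst heq
  exact hα.1.2 (by simpa using this)

lemma exists_isHighestRoot (hh : h.IsCartanSubalgebra) (hb : LieAlgebra.IsSolvable b)
    {α : Dual ℂ h} (hα : α ∈ roots Γ h) :
    ∃ θ, IsHighestRoot Γ h b θ ∧ GLE Γ h b (α, 0) (θ, 0) := by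
  obtain ⟨_, ⟨θ, hθ, rfl⟩, hle, hmax⟩ := exists_maximal hh hb
    ((finite_roots Γ h).image fun β => (β, (0 : ZMod n))) ⟨α, hα, rfl⟩
  refine ⟨θ, ⟨hθ, fun β hβ hβθ => ?_⟩, hle⟩
  exact congrArg Prod.fst (hmax (β, 0) ⟨β, hβ, rfl⟩ ⟨rfl, hβθ⟩)

/-- A subalgebra of `g_0` containing the Cartan subalgebra is the sum of root spaces for positive
roots and of elements of the Cartan subalgebra. -/
lemma image_le_iSup (hh : h.IsCartanSubalgebra) (hhb : h ≤ b) :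
    image b ≤ ⨆ β : {β : Dual ℂ h // β = 0 ∨ β ∈ posRoots Γ h b}, gr Γ h ((β : Dual ℂ h), 0) := by
  intro x hx
  obtain ⟨v, hv, hsum⟩ := (Submodule.mem_iSup_iff_exists_finsupp _ _).mp
    (mem_iSup_weightSpace hh (image_le hx))
  have hmem := mem_of_sum_mem (h := h) (N := image b)
    (fun t y hy => lie_mem_image ⟨t, hhb t.2, rfl⟩ hy) v.support v (fun μ _ => (hv μ).2)
    (by rw [← hsum] at hx; exact hx)
  rw [← hsum]
  refine sum_mem fun μ hμ => ?_
  have hμ0 := Finsupp.mem_support_iff.mp hμ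
  by_cases h0 : μ = 0
  · exact Submodule.mem_iSup_of_mem ⟨μ, Or.inl h0⟩ (hv μ)
  · refine Submodule.mem_iSup_of_mem ⟨μ, Or.inr ?_⟩ (hv μ)
    exact mem_posRoots ((Submodule.ne_bot_iff _).mpr ⟨_, hv μ, hμ0⟩) h0
      ((isRootGrading hh).le_of_mem h0 (hv μ) hμ0 (hmem μ hμ))

end Borel

/-! ### Weights of a nilpotent subalgebra -/

section Powers

variable {g : Type*} [LieRing g] [LieAlgebra ℂ g] {i : Submodule ℂ g}

/-- The subspace spanned by the iterated brackets `[x_1, [x_2, … [x_l, y] … ]]` of elements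
of `i`. -/
def power (i : Submodule ℂ g) : ℕ → Submodule ℂ g
  | 0 => i
  | l + 1 => Submodule.span ℂ {z | ∃ x ∈ i, ∃ y ∈ power i l, ⁅x, y⁆ = z}

lemma lie_mem_power_succ {l : ℕ} {x y : g} (hx : x ∈ i) (hy : y ∈ power i l) :
    ⁅x, y⁆ ∈ power i (l + 1) :=
  Submodule.subset_span ⟨x, hx, y, hy, rfl⟩

lemma power_succ_le_iff {l : ℕ} {N : Submodule ℂ g} :
    power i (l + 1) ≤ N ↔ ∀ x ∈ i, ∀ y ∈ power i l, ⁅x, y⁆ ∈ N := by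
  refine ⟨fun h x hx y hy => h (lie_mem_power_succ hx hy), fun h => Submodule.span_le.mpr ?_⟩
  rintro _ ⟨x, hx, y, hy, rfl⟩
  exact h x hx y hy

lemma power_le (hi : ∀ x ∈ i, ∀ y ∈ i, ⁅x, y⁆ ∈ i) (l : ℕ) : power i l ≤ i := by
  induction l with
  | zero => exact le_rfl
  | succ l ih => exact power_succ_le_iff.mpr fun x hx y hy => hi x hx y (ih hy)

lemma lie_mem_power_of_stable {x : g} (hx : ∀ y ∈ i, ⁅x, y⁆ ∈ i) (l : ℕ) {y : g}
    (hy : y ∈ power i l) : ⁅x, y⁆ ∈ power i l := by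
  induction l generalizing y with
  | zero => exact hx y hy
  | succ l ih =>
    have : power i (l + 1) ≤ (power i (l + 1)).comap (LieAlgebra.ad ℂ g x) := by
      refine power_succ_le_iff.mpr fun u hu v hv => ?_
      rw [Submodule.mem_comap, LieAlgebra.ad_apply, leibniz_lie]
      exact add_mem (lie_mem_power_succ (hx u hu) hv) (lie_mem_power_succ hu (ih hv))
    exact this hy

lemma lie_mem_power {l m : ℕ} {x y : g} (hx : x ∈ power i l) (hy : y ∈ power i m) :
    ⁅x, y⁆ ∈ power i (l + m + 1) := by
  induction l generalizing x y m with
  | zero => rw [zero_add]; exact lie_mem_power_succ hx hy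
  | succ l ih =>
    have : power i (l + 1) ≤
        (power i (l + 1 + m + 1)).comap (LieAlgebra.ad ℂ g y) := by
      refine power_succ_le_iff.mpr fun u hu v hv => ?_
      rw [Submodule.mem_comap, LieAlgebra.ad_apply, ← lie_skew, lie_lie]
      refine neg_mem (sub_mem ?_ ?_)
      · have := lie_mem_power_succ hu (ih hv hy)
        rwa [show l + m + 1 + 1 = l + 1 + m + 1 by omega] at this
      · have := ih hv (lie_mem_power_succ hu hy)
        rwa [show l + (m + 1) + 1 = l + 1 + m + 1 by omega] at this
    have h1 := this hx
    rw [Submodule.mem_comap, LieAlgebra.ad_apply, ← lie_skew] at h1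
    exact neg_mem_iff.mp h1

lemma foldr_lie (w : List g) (y : g) :
    w.foldr (fun x z => ⁅x, z⁆) y = (w.map (LieAlgebra.ad ℂ g)).prod y := by
  induction w with
  | nil => simp
  | cons x w ih => simp [ih]

lemma power_eq_bot {k : ℕ} (hi : ∀ w : List g, w.length = k → (∀ x ∈ w, x ∈ i) →
    ∀ y ∈ i, w.foldr (fun x z => ⁅x, z⁆) y = 0) {l : ℕ} (hl : k ≤ l) : power i l = ⊥ := by
  induction l, hl using Nat.le_induction with
  | base =>
    have key : ∀ l, ∀ w : List g, w.length + l = k → (∀ x ∈ w, x ∈ i) →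
        power i l ≤ LinearMap.ker (w.map (LieAlgebra.ad ℂ g)).prod := by
      intro l
      induction l with
      | zero =>
        intro w hw hwi y hy
        rw [LinearMap.mem_ker, ← foldr_lie]
        exact hi w hw hwi y hy
      | succ l ih =>
        intro w hw hwi
        refine power_succ_le_iff.mpr fun u hu v hv => ?_
        have h1 := ih (w ++ [u]) (by simp; omega) (fun x hx => by
          rcases List.mem_append.mp hx with hx | hx
          · exact hwi x hx
          · exact (List.mem_singleton.mp hx) ▸ hu) hv
        simpa using h1
    have := key k [] (by simp) (by simp)
    exact le_bot_iff.mp fun y hy => by simpa using this hy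
  | succ l hl ih =>
    refine le_bot_iff.mp (power_succ_le_iff.mpr fun x hx y hy => ?_)
    rw [ih, Submodule.mem_bot] at hy
    rw [hy, lie_zero]
    exact zero_mem _

end Powers

section Weights

variable {n : ℕ} {g : Type*} [LieRing g] [LieAlgebra ℂ g]
  {Γ : ZMod n → Submodule ℂ g} [GradedLieAlgebra Γ] {h b : LieSubalgebra ℂ (zero Γ)}
  {i : Submodule ℂ g} {k : ℕ}

variable (b i) in
/-- The filtration by `b_0` in level `0` and the powers of `i` in positive levels. -/
def filtration : ℕ → Submodule ℂ g
  | 0 => image b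
  | l + 1 => power i l

lemma lie_mem_filtration (hi : IsNilpotentGradedSubalgebra Γ b k i) (l m : ℕ) {x y : g}
    (hx : x ∈ filtration b i l) (hy : y ∈ filtration b i m) : ⁅x, y⁆ ∈ filtration b i (l + m) := by
  have hb : ∀ m, ∀ x ∈ image b, ∀ y ∈ power i m, ⁅x, y⁆ ∈ power i m := by
    rintro m _ ⟨x, hx, rfl⟩ y hy
    exact lie_mem_power_of_stable (fun y hy => hi.borel_lie_mem x hx y hy) m hy
  rcases l with _ | l <;> rcases m with _ | m
  · exact lie_mem_image hx hy
  · rw [zero_add]; exact hb m x hx y hy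
  · rw [← lie_skew, add_zero]; exact neg_mem (hb l y hy x hx)
  · have := lie_mem_power hx hy
    rwa [show l + 1 + (m + 1) = l + m + 1 + 1 by omega]

lemma filtration_eq_bot (hi : IsNilpotentGradedSubalgebra Γ b k i) {l : ℕ} (hl : k + 1 ≤ l) :
    filtration b i l = ⊥ := by
  obtain ⟨l, rfl⟩ := Nat.exists_eq_add_of_le' (show 1 ≤ l by omega)
  exact power_eq_bot hi.nilpotent (by omega)

lemma sum_map_pair (s : Multiset (Dual ℂ h × ZMod n)) :
    (s.map fun a => (a, 1)).sum = (s.sum, s.card) := by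
  induction s using Multiset.induction_on with
  | empty => rfl
  | cons a s ih =>
    rw [Multiset.map_cons, Multiset.sum_cons, ih, Multiset.sum_cons, Multiset.card_cons,
      Prod.mk_add_mk, add_comm 1]

lemma sum_map_root (s : Multiset (Dual ℂ h)) :
    (s.map fun β => (((β, 0), 0) : (Dual ℂ h × ZMod n) × ℕ)).sum = ((s.sum, 0), 0) := by
  induction s using Multiset.induction_on with
  | empty => rfl
  | cons a s ih =>
    rw [Multiset.map_cons, Multiset.sum_cons, ih, Multiset.sum_cons, Prod.mk_add_mk,
      Prod.mk_add_mk, add_zero, add_zero]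

lemma filtration_le (hi : IsNilpotentGradedSubalgebra Γ b k i) {m : ℕ} (hm : m ≠ 0) :
    filtration b i m ≤ i := by
  obtain ⟨m, rfl⟩ := Nat.exists_eq_succ_of_ne_zero hm
  exact power_le hi.lie_mem m

variable [FiniteDimensional ℂ g]

lemma finite_grwt (i : Submodule ℂ g) : (grwt Γ h i).Finite :=
  (finite_weights Γ h).subset fun _ ⟨x, _, hx, hx0⟩ => (Submodule.ne_bot_iff _).mpr ⟨x, hx, hx0⟩

variable [NeZero n] [LieAlgebra.IsKilling ℂ g]

/-- If `p` lies above a sum of `m` real weights of `i`, then the `m`-th power of `i` contains the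
weight space of weight `p`. -/
theorem gr_le_filtration (hh : h.IsCartanSubalgebra) (hb : LieAlgebra.IsSolvable b)
    (hi : IsNilpotentGradedSubalgebra Γ b k i) {s : Multiset (Dual ℂ h × ZMod n)} (hs0 : s ≠ 0)
    (hs : ∀ a ∈ s, gr Γ h a ≠ ⊥ ∧ a.1 ≠ 0 ∧ gr Γ h a ≤ i) {p : Dual ℂ h × ZMod n}
    (hp : GLE Γ h b s.sum p) : gr Γ h p ≤ filtration b i s.card := by
  have hG := isRootGrading (Γ := Γ) hh
  have hF : ∀ l m, ∀ x ∈ filtration b i l, ∀ y ∈ filtration b i m,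
      ⁅x, y⁆ ∈ filtration b i (l + m) := fun l m x hx y hy => lie_mem_filtration hi l m hx hy
  have hbot : ∀ l ≥ k + 1, filtration b i l = ⊥ := fun l hl => filtration_eq_bot hi hl
  obtain ⟨t, ht, htp⟩ := AddSubmonoid.exists_multiset_of_mem_closure hp.2
  have key := (hG.sum_mem_filtration hF (fun c c' l l' hc hc0 hcl hc' hc'0 hcl' => ?_)
    (s.map (fun a => (a, 1)) + t.map fun β => ((β, 0), 0)) (by simp [hs0]) (fun a ha => ?_)).2
  · rw [Multiset.sum_add, sum_map_pair, sum_map_root, htp] at key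
    have heq : s.sum + (p.1 - s.sum.1, (0 : ZMod n)) = p :=
      Prod.ext (add_sub_cancel _ _) ((add_zero _).trans hp.1)
    rwa [Prod.mk_add_mk, heq, add_zero] at key
  · by_cases hl : l = 0
    · by_cases hl' : l' = 0
      · subst hl hl'
        exact add_ne_zero_of_solvable hh hb hc hc0 hcl hc' hcl'
      · rw [add_comm]
        exact hG.add_ne_zero_of_nilpotent hF hbot hc' hc'0 hcl' hl' hc hcl
    · exact hG.add_ne_zero_of_nilpotent hF hbot hc hc0 hcl hl hc' hcl'
  · rcases Multiset.mem_add.mp ha with ha | ha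
    · obtain ⟨a', ha', rfl⟩ := Multiset.mem_map.mp ha
      exact hs a' ha'
    · obtain ⟨β, hβ, rfl⟩ := Multiset.mem_map.mp ha
      have hβ := (ht β hβ).1
      exact ⟨gr_ne_bot_of_posRoot hβ, hβ.1.2, gr_le_image hβ⟩

/-- The version of `gr_le_filtration` for indexed families of minimal weights of `i`. -/
lemma gr_le_filtration_of_minWeights (hh : h.IsCartanSubalgebra) (hb : LieAlgebra.IsSolvable b)
    (hi : IsNilpotentGradedSubalgebra Γ b k i) (hA : minWeights Γ h b i ⊆ sigmaPlus Γ h) {m : ℕ}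
    (hm : m ≠ 0) {a : Fin m → Dual ℂ h × ZMod n} (ha : ∀ r, a r ∈ minWeights Γ h b i)
    {p : Dual ℂ h × ZMod n} (hp : GLE Γ h b (∑ r, a r) p) : gr Γ h p ≤ filtration b i m := by
  have := gr_le_filtration hh hb hi (s := Finset.univ.val.map a) (fun h0 => hm ?_)
    (fun q hq => ?_) hp
  · simpa using this
  · simpa using congrArg Multiset.card h0
  · obtain ⟨r, -, rfl⟩ := Multiset.mem_map.mp hq
    obtain ⟨h1, h2, -⟩ := hA (ha r)
    obtain ⟨x, hx, hxr, hx0⟩ := (ha r).1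
    exact ⟨h1, h2, (isRootGrading hh).le_of_mem h2 hxr hx0 hx⟩

lemma not_gle_of_isHighestWeight (hh : h.IsCartanSubalgebra) (hb : LieAlgebra.IsSolvable b)
    (hi : IsNilpotentGradedSubalgebra Γ b k i) (hA : minWeights Γ h b i ⊆ sigmaPlus Γ h)
    {a : Fin (k + 1) → Dual ℂ h × ZMod n} (ha : ∀ r, a r ∈ minWeights Γ h b i) {l : Dual ℂ h}
    {j : ZMod n} (hl : IsHighestWeight Γ h b l j) : ¬ GLE Γ h b (∑ r, a r) (l, j) := by
  intro hle
  obtain ⟨v, hv, hv0, -⟩ := hl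
  have := gr_le_filtration_of_minWeights hh hb hi hA (Nat.succ_ne_zero k) ha hle hv
  rw [filtration_eq_bot hi le_rfl, Submodule.mem_bot] at this
  exact hv0 this

lemma not_gle_of_isHighestRoot (hh : h.IsCartanSubalgebra) (hb : LieAlgebra.IsSolvable b)
    (hi : IsNilpotentGradedSubalgebra Γ b k i) (hA : minWeights Γ h b i ⊆ sigmaPlus Γ h) {m : ℕ}
    (hm : m ≠ 0) {a : Fin m → Dual ℂ h × ZMod n} (ha : ∀ r, a r ∈ minWeights Γ h b i)
    {θ : Dual ℂ h} (hθ : IsHighestRoot Γ h b θ) : ¬ GLE Γ h b (∑ r, a r) (θ, 0) := by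
  intro hle
  obtain ⟨x, hx, hx0⟩ := Submodule.exists_mem_ne_zero_of_ne_bot hθ.1.1
  have hmem := hi.le_plus (filtration_le hi hm
    (gr_le_filtration_of_minWeights hh hb hi hA hm ha hle hx))
  have hker : plus Γ ≤ LinearMap.ker (comp Γ 0) :=
    iSup_le fun j y hy => comp_of_mem_ne Γ hy j.2
  refine hx0 ?_
  rw [← comp_of_mem Γ hx.1]
  exact hker hmem

lemma exists_minWeights_gle (hh : h.IsCartanSubalgebra) (hb : LieAlgebra.IsSolvable b)
    (hi : IsNilpotentGradedSubalgebra Γ b k i) (hA : minWeights Γ h b i ⊆ sigmaPlus Γ h)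
    {p q : Dual ℂ h × ZMod n} (hp : p ∈ minWeights Γ h b i) (hq : q ∈ minWeights Γ h b i)
    {r : Dual ℂ h × ZMod n} (hr : r ∈ sigmaPlus Γ h) (hle : GLE Γ h b (p + q) r) :
    ∃ a ∈ minWeights Γ h b i, GLE Γ h b a r := by
  have := (gr_le_filtration_of_minWeights hh hb hi hA two_ne_zero (a := ![p, q])
    (fun r => by fin_cases r <;> assumption) (by simpa using hle)).trans
    (filtration_le hi two_ne_zero)
  obtain ⟨x, hx, hx0⟩ := Submodule.exists_mem_ne_zero_of_ne_bot hr.1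
  obtain ⟨m, hm, hmr, hmin⟩ := exists_minimal hh hb (finite_grwt i) ⟨x, this hx, hx, hx0⟩
  exact ⟨m, ⟨hm, hmin⟩, hmr⟩

end Weights

/-! ### The subalgebra generated by an antichain -/

section Generated

lemma lie_mem_of_mem_iSup {g : Type*} [LieRing g] [LieAlgebra ℂ g] {ι κ : Sort*}
    {G : ι → Submodule ℂ g} {K : κ → Submodule ℂ g} {N : Submodule ℂ g}
    (hN : ∀ i j, ∀ x ∈ G i, ∀ y ∈ K j, ⁅x, y⁆ ∈ N) {x y : g} (hx : x ∈ ⨆ i, G i)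
    (hy : y ∈ ⨆ j, K j) : ⁅x, y⁆ ∈ N := by
  refine Submodule.iSup_induction G (motive := fun x => ⁅x, y⁆ ∈ N) hx (fun i x hx => ?_) ?_ ?_
  · refine Submodule.iSup_induction K (motive := fun y => ⁅x, y⁆ ∈ N) hy
      (fun j y hy => hN i j x hx y hy) ?_ ?_
    · rw [lie_zero]; exact zero_mem _
    · intro y z hy hz
      rw [lie_add]
      exact add_mem hy hz
  · rw [zero_lie]; exact zero_mem _
  · intro x z hx hz
    rw [add_lie]
    exact add_mem hx hz

lemma exists_fin_of_multiset {ι : Type*} [AddCommMonoid ι] (s : Multiset ι) {m : ℕ}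
    (hm : s.card = m) : ∃ a : Fin m → ι, (∀ r, a r ∈ s) ∧ ∑ r, a r = s.sum := by
  obtain ⟨L, rfl⟩ := Quotient.exists_rep s
  obtain rfl : L.length = m := hm
  refine ⟨L.get, fun r => L.get_mem r, ?_⟩
  rw [← List.sum_ofFn, List.ofFn_get]
  rfl

variable {n : ℕ} {g : Type*} [LieRing g] [LieAlgebra ℂ g]
  {Γ : ZMod n → Submodule ℂ g} [GradedLieAlgebra Γ] {h b : LieSubalgebra ℂ (zero Γ)} {k : ℕ}
  {A : Set (Dual ℂ h × ZMod n)}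

variable (b A) in
/-- The graded weights of non-zero degree which lie above an element of `A`. -/
def upperWeights : Set (Dual ℂ h × ZMod n) :=
  {q | gr Γ h q ≠ ⊥ ∧ q.2 ≠ 0 ∧ ∃ a ∈ A, GLE Γ h b a q}

variable (b A) in
/-- The sum of the graded weight spaces of non-zero degree whose weight lies above an element
of `A`. -/
def generated : Submodule ℂ g := ⨆ q : upperWeights b A, gr Γ h (q : Dual ℂ h × ZMod n)

variable (b A) in
/-- The sum of the graded weight spaces whose weight lies above a sum of `m` elements of `A`. -/
def level (m : ℕ) : Submodule ℂ g :=
  ⨆ q : {q : Dual ℂ h × ZMod n // ∃ s : Multiset (Dual ℂ h × ZMod n),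
    s.card = m ∧ (∀ a ∈ s, a ∈ A) ∧ GLE Γ h b s.sum q}, gr Γ h (q : Dual ℂ h × ZMod n)

lemma gr_le_generated {q : Dual ℂ h × ZMod n} (hq : q ∈ upperWeights b A) :
    gr Γ h q ≤ generated b A :=
  le_iSup (fun q : upperWeights b A => gr Γ h (q : Dual ℂ h × ZMod n)) ⟨q, hq⟩

lemma generated_le_level : generated b A ≤ level b A 1 := by
  refine iSup_le fun ⟨q, _, _, a, ha, haq⟩ => ?_
  refine le_iSup_of_le ⟨q, {a}, by simp, by simpa using ha, by simpa using haq⟩ le_rfl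

lemma lie_mem_level {m : ℕ} {x y : g} (hx : x ∈ generated b A) (hy : y ∈ level b A m) :
    ⁅x, y⁆ ∈ level b A (m + 1) := by
  refine lie_mem_of_mem_iSup ?_ hx hy
  rintro ⟨p, _, _, a, ha, hap⟩ ⟨q, s, hs, hsA, hsq⟩ u hu v hv
  refine Submodule.mem_iSup_of_mem ⟨p + q, a ::ₘ s, by simp [hs], ?_, ?_⟩
    (lie_mem_weightSpace Γ h hu hv)
  · intro c hc
    rcases Multiset.mem_cons.mp hc with rfl | hc
    · exact ha
    · exact hsA c hc
  · rw [Multiset.sum_cons]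
    exact hap.add hsq

lemma foldr_mem_level (w : List g) (hw : ∀ x ∈ w, x ∈ generated b A) {y : g}
    (hy : y ∈ generated b A) :
    w.foldr (fun x z => ⁅x, z⁆) y ∈ level b A (w.length + 1) := by
  induction w with
  | nil => exact generated_le_level hy
  | cons x w ih =>
    exact lie_mem_level (hw x (by simp)) (ih fun z hz => hw z (by simp [hz]))

lemma level_eq_bot {m : ℕ} (hA : ∀ s : Multiset (Dual ℂ h × ZMod n), s.card = m →
    (∀ a ∈ s, a ∈ A) → ∀ q, gr Γ h q ≠ ⊥ → ¬ GLE Γ h b s.sum q) : level b A m = ⊥ := by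
  refine iSup_eq_bot.mpr ?_
  rintro ⟨q, s, hs, hsA, hsq⟩
  by_contra hq
  exact hA s hs hsA q hq hsq

lemma grwt_generated : grwt Γ h (generated b A) = upperWeights b A := by
  ext p
  constructor
  · rintro ⟨x, hx, hxp, hx0⟩
    by_contra hp
    have hle : generated b A ≤ ⨆ q, ⨆ _ : q ≠ p, gr Γ h q :=
      iSup_le fun q => le_iSup₂_of_le (q : Dual ℂ h × ZMod n) (fun hqp => hp (hqp ▸ q.2)) le_rfl
    exact hx0 (Submodule.disjoint_def.mp (iSupIndep_weightSpace Γ h p) x hxp (hle hx))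
  · intro hp
    obtain ⟨x, hx, hx0⟩ := Submodule.exists_mem_ne_zero_of_ne_bot hp.1
    exact ⟨x, gr_le_generated hp hx, hx, hx0⟩

lemma generated_le_plus : generated b A ≤ plus Γ :=
  iSup_le fun ⟨q, _, hq, _⟩ _ hx => Submodule.mem_iSup_of_mem ⟨q.2, hq⟩ hx.1

lemma generated_eq_iSup_inf :
    generated b A = ⨆ j : {j : ZMod n // j ≠ 0}, generated b A ⊓ Γ j := by
  refine le_antisymm (iSup_le fun q x hx => ?_) (iSup_le fun j => inf_le_left)
  exact Submodule.mem_iSup_of_mem ⟨_, q.2.2.1⟩ ⟨gr_le_generated q.2 hx, hx.1⟩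

variable [FiniteDimensional ℂ g] [NeZero n] [LieAlgebra.IsKilling ℂ g]

lemma minWeights_generated (hh : h.IsCartanSubalgebra) (hb : LieAlgebra.IsSolvable b)
    (hA : A ⊆ sigmaPlus Γ h) (hanti : IsAntichain (GLE Γ h b) A) :
    A = minWeights Γ h b (generated b A) := by
  have hAu : ∀ a ∈ A, a ∈ upperWeights b A := fun a ha =>
    ⟨(hA ha).1, (hA ha).2.2, a, ha, GLE.refl a⟩
  ext p
  rw [minWeights, grwt_generated]
  constructor
  · refine fun hp => ⟨hAu p hp, fun q hq hqp => ?_⟩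
    obtain ⟨a, ha, haq⟩ := hq.2.2
    obtain rfl : a = p := hanti.eq ha hp (haq.trans hqp)
    exact GLE.antisymm hh hb hqp haq
  · rintro ⟨⟨-, -, a, ha, hap⟩, hmin⟩
    exact hmin a (hAu a ha) hap ▸ ha

lemma borel_lie_mem_generated (hh : h.IsCartanSubalgebra) (hb : LieAlgebra.IsSolvable b)
    (hhb : h ≤ b) {x y : g} (hx : x ∈ image b) (hy : y ∈ generated b A) :
    ⁅x, y⁆ ∈ generated b A := by
  refine lie_mem_of_mem_iSup ?_ (image_le_iSup hh hhb hx) hy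
  rintro ⟨β, hβ⟩ ⟨q, _, hq0, a, ha, haq⟩ u hu v hv
  by_cases huv : ⁅u, v⁆ = 0
  · rw [huv]; exact zero_mem _
  have hmem := lie_mem_weightSpace Γ h hu hv
  refine gr_le_generated (q := (β, 0) + q) ⟨(Submodule.ne_bot_iff _).mpr ⟨_, hmem, huv⟩, ?_, a, ha,
    haq.trans ⟨?_, ?_⟩⟩ hmem
  · rwa [Prod.snd_add, zero_add]
  · rw [Prod.snd_add, zero_add]
  · rw [Prod.fst_add, add_sub_cancel_right]
    rcases hβ with rfl | hβ
    · exact zero_mem _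
    · exact posRoots_subset_rootCone hh hb hβ

/-- If no sum of `k + 1` elements of `A` lies below a weight, then no two real weights above
elements of `A` have opposite parts in the dual of the Cartan subalgebra: such weights would give
rise to weights above sums of arbitrarily many elements of `A`. -/
lemma fst_ne_neg_fst (hh : h.IsCartanSubalgebra)
    (hA : ∀ s : Multiset (Dual ℂ h × ZMod n), s.card = k + 1 → (∀ a ∈ s, a ∈ A) →
      ∀ q, gr Γ h q ≠ ⊥ → ¬ GLE Γ h b s.sum q)
    {p q : Dual ℂ h × ZMod n} (hp : p ∈ upperWeights b A) (hp0 : p.1 ≠ 0)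
    (hq : q ∈ upperWeights b A) : q.1 ≠ -p.1 := by
  intro hqp
  obtain ⟨hp, -, a, ha, hap⟩ := hp
  obtain ⟨hq, -, a', ha', haq⟩ := hq
  have hrep : ∀ u v : ℕ, ∀ c ∈ Multiset.replicate u a + Multiset.replicate v a', c ∈ A := by
    intro u v c hc
    rcases Multiset.mem_add.mp hc with hc | hc
    · exact (Multiset.eq_of_mem_replicate hc) ▸ ha
    · exact (Multiset.eq_of_mem_replicate hc) ▸ ha'
  rcases Nat.even_or_odd' k with ⟨s, rfl | rfl⟩
  · refine hA (.replicate (s + 1) a + .replicate s a') (by simp; omega) (hrep _ _) _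
      ((isRootGrading hh).nsmul_ne_bot hp hp0 hq hqp s).1 ?_
    rw [Multiset.sum_add, Multiset.sum_replicate, Multiset.sum_replicate, smul_add, ← add_assoc,
      ← succ_nsmul']
    exact (hap.nsmul _).add (haq.nsmul _)
  · refine hA (.replicate (s + 1) a + .replicate (s + 1) a') (by simp; omega) (hrep _ _) _
      ((isRootGrading hh).nsmul_ne_bot hp hp0 hq hqp s).2 ?_
    rw [Multiset.sum_add, Multiset.sum_replicate, Multiset.sum_replicate, smul_add]
    exact (hap.nsmul _).add (haq.nsmul _)

/-- The brackets of the weight spaces of `generated b A`: those of weight zero vanish, those of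
degree zero are excluded by the assumption on roots, and the others lie above elements of `A`. -/
lemma lie_mem_generated (hh : h.IsCartanSubalgebra)
    (hA : ∀ s : Multiset (Dual ℂ h × ZMod n), s.card = k + 1 → (∀ a ∈ s, a ∈ A) →
      ∀ q, gr Γ h q ≠ ⊥ → ¬ GLE Γ h b s.sum q)
    (hroot : ∀ p ∈ A, ∀ q ∈ A, ∀ α ∈ roots Γ h, ¬ GLE Γ h b (p + q) (α, 0))
    (hadd : ∀ p ∈ A, ∀ q ∈ A, ∀ r ∈ sigmaPlus Γ h, GLE Γ h b (p + q) r → ∃ a ∈ A, GLE Γ h b a r)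
    {x y : g} (hx : x ∈ generated b A) (hy : y ∈ generated b A) : ⁅x, y⁆ ∈ generated b A := by
  refine lie_mem_of_mem_iSup ?_ hx hy
  rintro ⟨p, hp⟩ ⟨q, hq⟩ x hx y hy
  by_cases hxy : ⁅x, y⁆ = 0
  · rw [hxy]; exact zero_mem _
  have hmem : ⁅x, y⁆ ∈ gr Γ h (p + q) := lie_mem_weightSpace Γ h hx hy
  have hbot : gr Γ h (p + q) ≠ ⊥ := (Submodule.ne_bot_iff _).mpr ⟨_, hmem, hxy⟩
  obtain ⟨a, ha, hap⟩ := hp.2.2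
  obtain ⟨a', ha', haq⟩ := hq.2.2
  have h0 : (p + q).1 ≠ 0 := by
    intro h0
    have hqp : q.1 = -p.1 := (neg_eq_of_add_eq_zero_right h0).symm
    by_cases hp0 : p.1 = 0
    · rw [hp0, neg_zero] at hqp
      refine hxy (lie_eq_zero_of_weight_zero hh (i := p.2) (j := q.2) ?_ ?_)
      · rw [← hp0]; exact hx
      · rw [← hqp]; exact hy
    · exact fst_ne_neg_fst hh hA hp hp0 hq hqp
  by_cases hd : (p + q).2 = 0
  · have heq : p + q = ((p + q).1, 0) := Prod.ext rfl hd
    refine absurd (hap.add haq) ?_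
    rw [heq] at hbot ⊢
    exact hroot a ha a' ha' _ ⟨hbot, h0⟩
  · exact gr_le_generated ⟨hbot, hd, hadd a ha a' ha' _ ⟨hbot, h0, hd⟩ (hap.add haq)⟩ hmem

end Generated

end ZModGraded

theorem theorem2p2 {g : Type*} [LieRing g] [LieAlgebra ℂ g] [FiniteDimensional ℂ g]
    [LieAlgebra.IsSimple ℂ g] (n : ℕ) (hn : 1 ≤ n) (Γ : ZMod n → Submodule ℂ g)
    [GradedLieAlgebra Γ]
    (h : LieSubalgebra ℂ (ZModGraded.zero Γ)) (hh : h.IsCartanSubalgebra)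
    (b : LieSubalgebra ℂ (ZModGraded.zero Γ)) (hb : ZModGraded.IsBorel Γ b) (hhb : h ≤ b) (k : ℕ)
    (A : Set (Module.Dual ℂ h × ZMod n)) (hA : A ⊆ ZModGraded.sigmaPlus Γ h)
    (hanti : IsAntichain (ZModGraded.GLE Γ h b) A) :
    ZModGraded.Generates Γ h b k A ↔
      -- (i)
      (∀ a : Fin (k + 1) → Module.Dual ℂ h × ZMod n, (∀ r, a r ∈ A) →
        ∀ l : Module.Dual ℂ h, ZModGraded.IsHighestWeight Γ h b l (∑ r, (a r).2) →
          ¬ ZModGraded.GLE Γ h b (∑ r, a r) (l, ∑ r, (a r).2)) ∧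
      -- (ii)
      (∀ m : ℕ, 1 ≤ m → ∀ a : Fin m → Module.Dual ℂ h × ZMod n, (∀ r, a r ∈ A) →
        ∑ r, (a r).2 = 0 →
        ∀ θ : Module.Dual ℂ h, ZModGraded.IsHighestRoot Γ h b θ →
          ¬ ZModGraded.GLE Γ h b (∑ r, a r) (θ, 0)) ∧
      -- (iii)
      (∀ p ∈ A, ∀ q ∈ A, ∀ ν : Module.Dual ℂ h, (ν, p.2 + q.2) ∈ ZModGraded.sigmaPlus Γ h →
        ZModGraded.GLE Γ h b (p + q) (ν, p.2 + q.2) →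
        ∃ α : Module.Dual ℂ h, (α, p.2 + q.2) ∈ A ∧
          ZModGraded.GLE Γ h b (α, p.2 + q.2) (ν, p.2 + q.2)) := by
  have : NeZero n := ⟨by omega⟩
  have : LieAlgebra.IsKilling ℂ g := inferInstance
  have hsolv : LieAlgebra.IsSolvable b := hb.prop
  constructor
  · rintro ⟨i, hi, rfl⟩
    refine ⟨fun a ha l hl => ?_, fun m hm a ha _ θ hθ => ?_, fun p hp q hq ν hν hle => ?_⟩
    · exact ZModGraded.not_gle_of_isHighestWeight hh hsolv hi hA ha hl
    · exact ZModGraded.not_gle_of_isHighestRoot hh hsolv hi hA (by omega) ha hθ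
    · obtain ⟨⟨α, j⟩, hα, hle⟩ := ZModGraded.exists_minWeights_gle hh hsolv hi hA hp hq hν hle
      obtain rfl : j = p.2 + q.2 := hle.1
      exact ⟨α, hα, hle⟩
  · rintro ⟨h1, h2, h3⟩
    have hA1 : ∀ s : Multiset (Module.Dual ℂ h × ZMod n), s.card = k + 1 → (∀ a ∈ s, a ∈ A) →
        ∀ q, ZModGraded.gr Γ h q ≠ ⊥ → ¬ ZModGraded.GLE Γ h b s.sum q := by
      intro s hs hsA q hq hle
      obtain ⟨a, has, hsum⟩ := ZModGraded.exists_fin_of_multiset s hs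
      obtain ⟨l, hl, hql⟩ := ZModGraded.exists_isHighestWeight hh hsolv hq
      have hdeg : ∑ r, (a r).2 = q.2 := by rw [← Prod.snd_sum, hsum]; exact hle.1
      refine h1 a (fun r => hsA _ (has r)) l ?_ ?_ <;> rw [hdeg]
      · exact hl
      · rw [hsum]; exact hle.trans hql
    have hA2 : ∀ p ∈ A, ∀ q ∈ A, ∀ α ∈ ZModGraded.roots Γ h,
        ¬ ZModGraded.GLE Γ h b (p + q) (α, 0) := by
      intro p hp q hq α hα hle
      obtain ⟨θ, hθ, hαθ⟩ := ZModGraded.exists_isHighestRoot hh hsolv hα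
      refine h2 2 one_le_two ![p, q] (fun r => by fin_cases r <;> assumption) ?_ θ hθ ?_
      · simpa using hle.1
      · simpa using hle.trans hαθ
    have hA3 : ∀ p ∈ A, ∀ q ∈ A, ∀ r ∈ ZModGraded.sigmaPlus Γ h,
        ZModGraded.GLE Γ h b (p + q) r → ∃ a ∈ A, ZModGraded.GLE Γ h b a r := by
      rintro p hp q hq ⟨ν, j⟩ hr hle
      obtain rfl : p.2 + q.2 = j := hle.1
      obtain ⟨α, hα, hαν⟩ := h3 p hp q hq ν hr hle
      exact ⟨_, hα, hαν⟩
    refine ⟨ZModGraded.generated b A, ?_, ZModGraded.minWeights_generated hh hsolv hA hanti⟩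
    exact
      { le_plus := ZModGraded.generated_le_plus
        lie_mem := fun x hx y hy => ZModGraded.lie_mem_generated hh hA1 hA2 hA3 hx hy
        borel_lie_mem := fun x hx y hy =>
          ZModGraded.borel_lie_mem_generated hh hsolv hhb ⟨x, hx, rfl⟩ hy
        nilpotent := fun w hw hwi y hy => by
          have := ZModGraded.foldr_mem_level w hwi hy
          rwa [hw, ZModGraded.level_eq_bot hA1, Submodule.mem_bot] at this
        graded := ZModGraded.generated_eq_iSup_inf }
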